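/- Consider the problem \[ \min\ F(x,y)=f(x)+\theta(y)\quad\text{s.t.}\quad Ax+By-b=0,\ \ Ex+Fy-d\le 0,\ \ l\le Cx\le v,\ \ s\le Dy\le r, \] with $x\in\mathbb R^{n_1}$, $y\in\mathbb R^{n_2}$, $f,\theta$ continuously differentiable, $l<v$, $s<r$ componentwise, where entries of $l,s$ may be $-\infty$ and entries of $v,r$ may be $+\infty$. Let $\mathcal X=\{x: l\le Cx\le v\}$, $\mathcal Y=\{y: s\le Dy\le r\}$, $\mathcal F_+=\{(x,y)\in\mathcal X\times\mathcal Y: Ex+Fy-d\le0\}$, $\mathcal L_\beta(x,y,\lambda)=f(x)+\theta(y)-\lambda^\top(Ax+By-b)+\frac\beta2\|Ax+By-b\|^2$, $\|z\|_H^2=z^\top Hz$, and write $u=(x,y)$, $w=(x,y,\lambda)$; $\|\cdot\|$ is the Euclidean norm. *The PFD-SQO$_c$ method.* Parameters: $\rho,\sigma\in(0,1)$, $c\in[0,1]$, $\tau_1,\tau_2,\beta,\xi,M,M_1>0$, $M_2\ge0$. Start with $u_0\in\mathcal F_+$, $\lambda_0$, and symmetric positive definite $H_0^x,H_0^y$.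 At iteration $k$, with symmetric $H_k^x,H_k^y$, put $h_k=Ex_k+Fy_k-d$, $\mathcal H_k^x=H_k^x+\beta A^\top A$, $\mathcal H_k^y=H_k^y+\beta B^\top B$, \[ \mathcal H_k^u=\begin{pmatrix}\mathcal H_k^x&0\\0&\mathcal H_k^y\end{pmatrix},\qquad \hat{\mathcal H}_k^u=\begin{pmatrix}\mathcal H_k^x&\beta A^\top B\\ \beta B^\top A&\mathcal H_k^y\end{pmatrix}, \] where $\mathcal H_k^x$, $\mathcal H_k^y$ and $\hat{\mathcal H}_k^u$ are positive definite. (1) Solve $\min\{\nabla_x\mathcal L_\beta(w_k)^\top(x-x_k)+\frac12\|x-x_k\|^2_{\mathcal H^x_k}: Ex+Fy_k-d\le\frac c2h_k,\ x\in\mathcal X\}$ and $\min\{\nabla_y\mathcal L_\beta(w_k)^\top(y-y_k)+\frac12\|y-y_k\|^2_{\mathcal H^y_k}: Ex_k+Fy-d\le\frac c2h_k,\ y\in\mathcal Y\}$, obtaining the optimal solutions $\tilde x_{k+1},\tilde y_{k+1}$ with KKT multipliers $(\mu_k^x,\alpha_k^x,\gamma_k^x)$ and $(\mu_k^y,\alpha_k^y,\gamma_k^y)$.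 (2) Let $d_k^u=(\tilde x_{k+1}-x_k,\tilde y_{k+1}-y_k)$. If $\min\{\|\mu_k^x\|,\|\mu_k^y\|\}\le M$ and $\|\mu_k^x-\mu_k^y\|\le M_1(\|d_k^u\|^{\tau_1}+M_2\|Ax_k+By_k-b\|^{\tau_2})$, set $\tilde{\mathcal H}_k^u=\mathcal H_k^u$, $c_{\max}=\frac1{2-c}$ and go to (4). (3) Otherwise let $(\tilde x_{k+1},\tilde y_{k+1})$ be instead the minimizer over $\mathcal F_+$ of $\nabla f(x_k)^\top(x-x_k)+\frac12\|x-x_k\|^2_{H_k^x}+\nabla\theta(y_k)^\top(y-y_k)+\frac12\|y-y_k\|^2_{H_k^y}-\lambda_k^\top(Ax+By-b)+\frac\beta2\|Ax+By-b\|^2$ (with corresponding KKT multipliers), $d_k^u=(\tilde x_{k+1}-x_k,\tilde y_{k+1}-y_k)$, $\tilde{\mathcal H}_k^u=\hat{\mathcal H}_k^u$, $c_{\max}=1$. (4) Let $t_k$ be the largest $t\in\{c_{\max}\sigma^i:i=0,1,2,\dots\}$ with $\mathcal L_\beta(u_k+td_k^u,\lambda_k)\le\mathcal L_\beta(w_k)-\rho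 t\|d_k^u\|^2_{\tilde{\mathcal H}_k^u}$. (5) Set $u_{k+1}=u_k+t_kd_k^u$, $\lambda_{k+1}=\lambda_k+\xi(Ax_{k+1}+By_{k+1}-b)$. Stop if $u_{k+1}=u_k$ and $Ax_{k+1}+By_{k+1}=b$; otherwise choose new symmetric $H_{k+1}^x,H_{k+1}^y$ with the positive definiteness above and continue. *Notation.* At $u=(x,y)$ let $I_x^l,I_x^v$ (respectively $J_y^s,J_y^r$) be the sets of indices at which $Cx$ equals $l$, $v$ ($Dy$ equals $s$, $r$), $I_x=I_x^l\cup I_x^v$, $J_y=J_y^s\cup J_y^r$, and $S_u=\{i:(Ex+Fy-d)_i=0\}$. For index sets $S,I,J$ let $\mathcal B(S,I,J)$ be the matrix with block rows $(E_S\ F_S)$, $(C_I\ 0)$, $(0\ D_J)$. For each $k$ let $S_k^+=S_{(\tilde x_{k+1},\tilde y_{k+1})}$ if step (3) was used, and otherwise $S_k^+=\{i:(E\tilde x_{k+1}+Fy_k-d-\frac12h_k)_i=0\}\cap\{i:(Ex_k+F\tilde y_{k+1}-d-\frac12h_k)_i=0\}$; let $\mathcal B_k=\mathcal B(S_k^+,I_{\tilde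 x_{k+1}},J_{\tilde y_{k+1}})$ and $P_k=I-\mathcal B_k^\top(\mathcal B_k\mathcal B_k^\top)^{-1}\mathcal B_k$ (under the assumptions below $\mathcal B_k$ has full row rank for all large $k$). **Theorem.** Let $c=1$ and $\rho\in(0,\frac12)$, and let $\{w_k\}$ be an infinite sequence generated by the method. Assume: (a) there is $\eta>0$ with $\mathcal H_k^u\succeq\eta I$ and $\hat{\mathcal H}_k^u\succeq\eta I$ for all $k$, and $\{\mathcal H_k^u\}_{k\in K}$, $\{\hat{\mathcal H}_k^u\}_{k\in K}$ are bounded whenever $\{w_k\}_{k\in K}$ is bounded; (b) $f$ and $\theta$ are twice continuously differentiable in a neighborhood of $\mathcal F_+$; $\{w_k\}$ is bounded and has an accumulation point $w_*=(x_*,y_*,\lambda_*)$, with $u_*=(x_*,y_*)$, such that the rows of $(A\ B)$ and of $\mathcal B(S_{u_*},I_{x_*},J_{y_*})$ are together linearly independent, and such that, for the multipliers $(\mu_*,\alpha_*^x,\gamma_*^x,\alpha_*^y,\gamma_*^y)$ that together with $w_*$ form a primal-dual KKT solution of the problem, $z^\top\nabla^2F(x_*,y_*)z>0$ for every $z\ne0$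 that is orthogonal to the rows of $(A\ B)$ and to those rows of $\mathcal B(S_{u_*},I_{x_*},J_{y_*})$ whose multiplier (for $I^l_{x_*},I^v_{x_*},J^s_{y_*},J^r_{y_*},S_{u_*}$: the component of $\alpha_*^x,\gamma_*^x,\alpha_*^y,\gamma_*^y,\mu_*$ respectively) is positive; (c) $A^\top B=0$; (d) either $\|(\mathcal H_k^u-\nabla^2_{uu}\mathcal L_\beta(w_k))d_k^u\|=o(\|d_k^u\|)$, or both $\|P_k(\mathcal H_k^u-\nabla^2_{uu}\mathcal L_\beta(w_k))d_k^u\|=o(\|d_k^u\|)$ and strict complementarity holds at $w_*$: $(\alpha_*^x)_{I^l_{x_*}}>0$, $(\gamma_*^x)_{I^v_{x_*}}>0$, $(\alpha_*^y)_{J^s_{y_*}}>0$, $(\gamma_*^y)_{J^r_{y_*}}>0$, $(\mu_*)_{S_{u_*}}>0$. Then $t_k=1$ for all sufficiently large $k$. -/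

import Mathlib

open Filter Asymptotics Topology
open scoped Matrix

noncomputable section

namespace PFDSQO

/-! ### Vectors, gradients, Hessians, complementarity -/

/-- The Euclidean norm of a column vector. -/
def enorm2 {ι : Type} [Fintype ι] (z : ι → ℝ) : ℝ :=
  ‖(WithLp.toLp 2 z : EuclideanSpace ℝ ι)‖

/-- The quadratic form `‖z‖²_H = zᵀ H z`. -/
def qnorm {ι : Type} [Fintype ι] (H : Matrix ι ι ℝ) (z : ι → ℝ) : ℝ :=
  z ⬝ᵥ (H *ᵥ z)

/-- The gradient, as the vector of partial derivatives. -/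
def grad {ι : Type} [Fintype ι] [DecidableEq ι] (g : (ι → ℝ) → ℝ) (z : ι → ℝ) : ι → ℝ :=
  fun i => fderiv ℝ g z (Pi.single i 1)

/-- The Hessian matrix of second partial derivatives. -/
def hess {ι : Type} [Fintype ι] [DecidableEq ι] (g : (ι → ℝ) → ℝ) (z : ι → ℝ) :
    Matrix ι ι ℝ :=
  Matrix.of fun i j => fderiv ℝ (fderiv ℝ g) z (Pi.single i 1) (Pi.single j 1)

/-- `0 ≤ a ⊥ g ≥ 0`. -/
def Complementary {ι : Type} (a g : ι → ℝ) : Prop :=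
  ∀ i, 0 ≤ a i ∧ 0 ≤ g i ∧ a i * g i = 0

/-- `0 ≤ α ⊥ (z - lo) ≥ 0` and `0 ≤ γ ⊥ (hi - z) ≥ 0`, where `lo` and `hi` may have infinite
entries; the products are taken in `EReal`, where `a * ⊤ = 0` exactly when `a = 0`. -/
def BoxCompl {ι : Type} (lo hi : ι → EReal) (z α γ : ι → ℝ) : Prop :=
  ∀ i, (0 ≤ α i ∧ lo i ≤ (z i : EReal) ∧ (α i : EReal) * ((z i : EReal) - lo i) = 0) ∧
    (0 ≤ γ i ∧ (z i : EReal) ≤ hi i ∧ (γ i : EReal) * (hi i - (z i : EReal)) = 0)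

/-! ### The optimization problem -/

/-- The data of the problem: minimize `f x + θ y` subject to `A x + B y - b = 0`,
`E x + F y - d ≤ 0`, `l ≤ C x ≤ v`, `s ≤ D y ≤ r`. The bounds are extended reals; `l < v` and
`s < r` force `l, s < ∞` and `v, r > -∞`. -/
structure Problem (n₁ n₂ m₁ m₂ l₁ l₂ : ℕ) where
  f : (Fin n₁ → ℝ) → ℝ
  θ : (Fin n₂ → ℝ) → ℝ
  A : Matrix (Fin m₁) (Fin n₁) ℝ
  B : Matrix (Fin m₁) (Fin n₂) ℝ
  b : Fin m₁ → ℝ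
  E : Matrix (Fin m₂) (Fin n₁) ℝ
  F : Matrix (Fin m₂) (Fin n₂) ℝ
  d : Fin m₂ → ℝ
  C : Matrix (Fin l₁) (Fin n₁) ℝ
  D : Matrix (Fin l₂) (Fin n₂) ℝ
  l : Fin l₁ → EReal
  v : Fin l₁ → EReal
  s : Fin l₂ → EReal
  r : Fin l₂ → EReal
  f_smooth : ContDiff ℝ 1 f
  θ_smooth : ContDiff ℝ 1 θ
  l_lt_v : ∀ i, l i < v i
  s_lt_r : ∀ j, s j < r j

namespace Problem

variable {n₁ n₂ m₁ m₂ l₁ l₂ : ℕ} (P : Problem n₁ n₂ m₁ m₂ l₁ l₂)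

/-- The residual `A x + B y - b` of the equality constraint. -/
def res (x : Fin n₁ → ℝ) (y : Fin n₂ → ℝ) : Fin m₁ → ℝ :=
  P.A *ᵥ x + P.B *ᵥ y - P.b

/-- The value `h = E x + F y - d` of the linear inequality constraint. -/
def ineq (x : Fin n₁ → ℝ) (y : Fin n₂ → ℝ) : Fin m₂ → ℝ :=
  P.E *ᵥ x + P.F *ᵥ y - P.d

/-- The set `𝒳 = {x | l ≤ C x ≤ v}`. -/
def setX : Set (Fin n₁ → ℝ) :=
  {x | ∀ i, P.l i ≤ ((P.C *ᵥ x) i : EReal) ∧ ((P.C *ᵥ x) i : EReal) ≤ P.v i}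

/-- The set `𝒴 = {y | s ≤ D y ≤ r}`. -/
def setY : Set (Fin n₂ → ℝ) :=
  {y | ∀ j, P.s j ≤ ((P.D *ᵥ y) j : EReal) ∧ ((P.D *ᵥ y) j : EReal) ≤ P.r j}

/-- The partially feasible set `ℱ₊`: all constraints but the equality constraint. -/
def feasPlus : Set ((Fin n₁ → ℝ) × (Fin n₂ → ℝ)) :=
  {u | u.1 ∈ P.setX ∧ u.2 ∈ P.setY ∧ P.ineq u.1 u.2 ≤ 0}

/-- The objective `F(x, y) = f x + θ y`, as a function of the stacked vector `u = (x, y)`. -/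
def obj (u : Fin n₁ ⊕ Fin n₂ → ℝ) : ℝ :=
  P.f (u ∘ Sum.inl) + P.θ (u ∘ Sum.inr)

/-- The augmented Lagrangian function `ℒ_β(x, y, λ)` of the equality constraint. -/
def augLag (β : ℝ) (x : Fin n₁ → ℝ) (y : Fin n₂ → ℝ) (lam : Fin m₁ → ℝ) : ℝ :=
  P.f x + P.θ y - lam ⬝ᵥ P.res x y + β / 2 * enorm2 (P.res x y) ^ 2

/-- The Hessian `∇²_{uu} ℒ_β(w)` with respect to the stacked vector `u = (x, y)`. -/
def hessAugLag (β : ℝ) (x : Fin n₁ → ℝ) (y : Fin n₂ → ℝ) (lam : Fin m₁ → ℝ) :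
    Matrix (Fin n₁ ⊕ Fin n₂) (Fin n₁ ⊕ Fin n₂) ℝ :=
  hess (fun u : Fin n₁ ⊕ Fin n₂ → ℝ => P.augLag β (u ∘ Sum.inl) (u ∘ Sum.inr) lam)
    (Sum.elim x y)

/-! Active sets. -/

open Classical in
/-- `I^l_x`. -/
def actL (x : Fin n₁ → ℝ) : Finset (Fin l₁) :=
  Finset.univ.filter fun i => ((P.C *ᵥ x) i : EReal) = P.l i

open Classical in
/-- `I^v_x`. -/
def actV (x : Fin n₁ → ℝ) : Finset (Fin l₁) :=
  Finset.univ.filter fun i => ((P.C *ᵥ x) i : EReal) = P.v i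

/-- `I_x = I^l_x ∪ I^v_x`. -/
def actX (x : Fin n₁ → ℝ) : Finset (Fin l₁) := P.actL x ∪ P.actV x

open Classical in
/-- `J^s_y`. -/
def actS (y : Fin n₂ → ℝ) : Finset (Fin l₂) :=
  Finset.univ.filter fun j => ((P.D *ᵥ y) j : EReal) = P.s j

open Classical in
/-- `J^r_y`. -/
def actR (y : Fin n₂ → ℝ) : Finset (Fin l₂) :=
  Finset.univ.filter fun j => ((P.D *ᵥ y) j : EReal) = P.r j

/-- `J_y = J^s_y ∪ J^r_y`. -/
def actY (y : Fin n₂ → ℝ) : Finset (Fin l₂) := P.actS y ∪ P.actR y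

open Classical in
/-- `S_u`: the active rows of `E x + F y - d ≤ 0`. -/
def actIneq (x : Fin n₁ → ℝ) (y : Fin n₂ → ℝ) : Finset (Fin m₂) :=
  Finset.univ.filter fun i => P.ineq x y i = 0

/-- The matrix with rows `(E_S F_S)`, `(C_I 0)`, `(0 D_J)`. -/
def rowsIneq (S : Finset (Fin m₂)) (I : Finset (Fin l₁)) (J : Finset (Fin l₂)) :
    Matrix (S ⊕ (I ⊕ J)) (Fin n₁ ⊕ Fin n₂) ℝ :=
  Matrix.fromRows
    (Matrix.fromCols (P.E.submatrix Subtype.val id) (P.F.submatrix Subtype.val id))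
    (Matrix.fromBlocks (P.C.submatrix Subtype.val id) 0 0 (P.D.submatrix Subtype.val id))

/-- The matrix with rows `(A B)`, `(E_S F_S)`, `(C_I 0)`, `(0 D_J)`. -/
def rowsAll (S : Finset (Fin m₂)) (I : Finset (Fin l₁)) (J : Finset (Fin l₂)) :
    Matrix (Fin m₁ ⊕ (S ⊕ (I ⊕ J))) (Fin n₁ ⊕ Fin n₂) ℝ :=
  Matrix.fromRows (Matrix.fromCols P.A P.B) (P.rowsIneq S I J)

end Problem

/-- Multipliers `(μ, α^x, γ^x, α^y, γ^y)` of the inequality constraints. -/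
structure Mult (m₂ l₁ l₂ : ℕ) where
  μ : Fin m₂ → ℝ
  αx : Fin l₁ → ℝ
  γx : Fin l₁ → ℝ
  αy : Fin l₂ → ℝ
  γy : Fin l₂ → ℝ

namespace Problem

variable {n₁ n₂ m₁ m₂ l₁ l₂ : ℕ} (P : Problem n₁ n₂ m₁ m₂ l₁ l₂)

/-- `(x, y; λ, μ, α^x, γ^x, α^y, γ^y)` is a primal-dual KKT solution of the problem. -/
structure IsKKT (x : Fin n₁ → ℝ) (y : Fin n₂ → ℝ) (lam : Fin m₁ → ℝ) (Λ : Mult m₂ l₁ l₂) :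
    Prop where
  stat_x : grad P.f x - P.Aᵀ *ᵥ lam + P.Eᵀ *ᵥ Λ.μ + P.Cᵀ *ᵥ (Λ.γx - Λ.αx) = 0
  stat_y : grad P.θ y - P.Bᵀ *ᵥ lam + P.Fᵀ *ᵥ Λ.μ + P.Dᵀ *ᵥ (Λ.γy - Λ.αy) = 0
  eq : P.res x y = 0
  ineq : Complementary Λ.μ (-(P.ineq x y))
  boxX : BoxCompl P.l P.v (P.C *ᵥ x) Λ.αx Λ.γx
  boxY : BoxCompl P.s P.r (P.D *ᵥ y) Λ.αy Λ.γy

/-- Linear independence constraint qualification at `(x, y)`. -/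
def LICQ (x : Fin n₁ → ℝ) (y : Fin n₂ → ℝ) : Prop :=
  LinearIndependent ℝ (P.rowsAll (P.actIneq x y) (P.actX x) (P.actY y)).row

open Classical in
/-- Strong second-order sufficient condition at `(x, y)` with multipliers `Λ`: the Hessian of the
objective is positive definite on the null space of the equality rows and of those active rows
whose multiplier is positive. -/
def SSOS (x : Fin n₁ → ℝ) (y : Fin n₂ → ℝ) (Λ : Mult m₂ l₁ l₂) : Prop :=
  ∀ z : Fin n₁ ⊕ Fin n₂ → ℝ, z ≠ 0 →
    P.rowsAll ((P.actIneq x y).filter fun i => 0 < Λ.μ i)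
      (((P.actL x).filter fun i => 0 < Λ.αx i) ∪ ((P.actV x).filter fun i => 0 < Λ.γx i))
      (((P.actS y).filter fun j => 0 < Λ.αy j) ∪ ((P.actR y).filter fun j => 0 < Λ.γy j))
        *ᵥ z = 0 →
    0 < qnorm (hess P.obj (Sum.elim x y)) z

/-- Strict complementarity at `(x, y)` with multipliers `Λ`. -/
def StrictCompl (x : Fin n₁ → ℝ) (y : Fin n₂ → ℝ) (Λ : Mult m₂ l₁ l₂) : Prop :=
  (∀ i ∈ P.actL x, 0 < Λ.αx i) ∧ (∀ i ∈ P.actV x, 0 < Λ.γx i) ∧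
  (∀ j ∈ P.actS y, 0 < Λ.αy j) ∧ (∀ j ∈ P.actR y, 0 < Λ.γy j) ∧
  (∀ i ∈ P.actIneq x y, 0 < Λ.μ i)

end Problem

/-! ### The algorithm -/

/-- The parameters of the method. -/
structure Params where
  ρ : ℝ
  τ₁ : ℝ
  τ₂ : ℝ
  c : ℝ
  σ : ℝ
  β : ℝ
  ξ : ℝ
  M : ℝ
  M₁ : ℝ
  M₂ : ℝ
  ρ_mem : ρ ∈ Set.Ioo (0 : ℝ) 1
  τ₁_pos : 0 < τ₁
  τ₂_pos : 0 < τ₂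
  c_mem : c ∈ Set.Icc (0 : ℝ) 1
  σ_mem : σ ∈ Set.Ioo (0 : ℝ) 1
  β_pos : 0 < β
  ξ_pos : 0 < ξ
  M_pos : 0 < M
  M₁_pos : 0 < M₁
  M₂_nonneg : 0 ≤ M₂

/-- Solutions `x̃, ỹ` of the two split subproblems with multipliers
`(μ^x, α^x, γ^x)` and `(μ^y, α^y, γ^y)`. -/
structure SplitSol (n₁ n₂ m₂ l₁ l₂ : ℕ) where
  x : Fin n₁ → ℝ
  y : Fin n₂ → ℝ
  μx : Fin m₂ → ℝ
  αx : Fin l₁ → ℝ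
  γx : Fin l₁ → ℝ
  μy : Fin m₂ → ℝ
  αy : Fin l₂ → ℝ
  γy : Fin l₂ → ℝ

/-- A solution `(x̃, ỹ)` of the joint subproblem with its multipliers. -/
structure JointSol (n₁ n₂ m₂ l₁ l₂ : ℕ) where
  x : Fin n₁ → ℝ
  y : Fin n₂ → ℝ
  mult : Mult m₂ l₁ l₂

section Subproblems

variable {n₁ n₂ m₁ m₂ l₁ l₂ : ℕ} (P : Problem n₁ n₂ m₁ m₂ l₁ l₂) (p : Params)
  (x : Fin n₁ → ℝ) (y : Fin n₂ → ℝ) (lam : Fin m₁ → ℝ)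
  (Hx : Matrix (Fin n₁) (Fin n₁) ℝ) (Hy : Matrix (Fin n₂) (Fin n₂) ℝ)

/-- `ℋ^x = H^x + β AᵀA`. -/
def calHx : Matrix (Fin n₁) (Fin n₁) ℝ := Hx + p.β • (P.Aᵀ * P.A)

/-- `ℋ^y = H^y + β BᵀB`. -/
def calHy : Matrix (Fin n₂) (Fin n₂) ℝ := Hy + p.β • (P.Bᵀ * P.B)

/-- `ℋ^u = diag(ℋ^x, ℋ^y)`. -/
def calHu : Matrix (Fin n₁ ⊕ Fin n₂) (Fin n₁ ⊕ Fin n₂) ℝ :=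
  Matrix.fromBlocks (calHx P p Hx) 0 0 (calHy P p Hy)

/-- `ℋ̂^u = [ℋ^x, β AᵀB; β BᵀA, ℋ^y]`. -/
def hatHu : Matrix (Fin n₁ ⊕ Fin n₂) (Fin n₁ ⊕ Fin n₂) ℝ :=
  Matrix.fromBlocks (calHx P p Hx) (p.β • (P.Aᵀ * P.B)) (p.β • (P.Bᵀ * P.A)) (calHy P p Hy)

/-- `∇_x ℒ_β(w) = ∇f(x) - Aᵀ(λ - β(Ax + By - b))`. -/
def gradX : Fin n₁ → ℝ := grad P.f x - P.Aᵀ *ᵥ (lam - p.β • P.res x y)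

/-- `∇_y ℒ_β(w) = ∇θ(y) - Bᵀ(λ - β(Ax + By - b))`. -/
def gradY : Fin n₂ → ℝ := grad P.θ y - P.Bᵀ *ᵥ (lam - p.β • P.res x y)

/-- Feasible set of the `x`-subproblem at the current point `(x, y)`. -/
def feasX : Set (Fin n₁ → ℝ) :=
  {z | z ∈ P.setX ∧ P.ineq z y ≤ (p.c / 2) • P.ineq x y}

/-- Feasible set of the `y`-subproblem at the current point `(x, y)`. -/
def feasY : Set (Fin n₂ → ℝ) :=
  {z | z ∈ P.setY ∧ P.ineq x z ≤ (p.c / 2) • P.ineq x y}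

/-- Objective of the `x`-subproblem. -/
def objX (z : Fin n₁ → ℝ) : ℝ :=
  gradX P p x y lam ⬝ᵥ (z - x) + 1 / 2 * qnorm (calHx P p Hx) (z - x)

/-- Objective of the `y`-subproblem. -/
def objY (z : Fin n₂ → ℝ) : ℝ :=
  gradY P p x y lam ⬝ᵥ (z - y) + 1 / 2 * qnorm (calHy P p Hy) (z - y)

/-- Objective of the joint subproblem. -/
def objJoint (z : (Fin n₁ → ℝ) × (Fin n₂ → ℝ)) : ℝ :=
  grad P.f x ⬝ᵥ (z.1 - x) + 1 / 2 * qnorm Hx (z.1 - x)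
    + (grad P.θ y ⬝ᵥ (z.2 - y) + 1 / 2 * qnorm Hy (z.2 - y))
    - lam ⬝ᵥ P.res z.1 z.2 + p.β / 2 * enorm2 (P.res z.1 z.2) ^ 2

/-- `T` consists of the optimal solutions of the two split subproblems and of corresponding
KKT multipliers. -/
structure IsSplitSol (T : SplitSol n₁ n₂ m₂ l₁ l₂) : Prop where
  feas_x : T.x ∈ feasX P p x y
  min_x : IsMinOn (objX P p x y lam Hx) (feasX P p x y) T.x
  stat_x : gradX P p x y lam + calHx P p Hx *ᵥ (T.x - x) + P.Eᵀ *ᵥ T.μx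
    + P.Cᵀ *ᵥ (T.γx - T.αx) = 0
  compl_x : Complementary T.μx ((p.c / 2) • P.ineq x y - P.ineq T.x y)
  box_x : BoxCompl P.l P.v (P.C *ᵥ T.x) T.αx T.γx
  feas_y : T.y ∈ feasY P p x y
  min_y : IsMinOn (objY P p x y lam Hy) (feasY P p x y) T.y
  stat_y : gradY P p x y lam + calHy P p Hy *ᵥ (T.y - y) + P.Fᵀ *ᵥ T.μy
    + P.Dᵀ *ᵥ (T.γy - T.αy) = 0
  compl_y : Complementary T.μy ((p.c / 2) • P.ineq x y - P.ineq x T.y)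
  box_y : BoxCompl P.s P.r (P.D *ᵥ T.y) T.αy T.γy

/-- `T` consists of the optimal solution of the joint subproblem and of corresponding
KKT multipliers. -/
structure IsJointSol (T : JointSol n₁ n₂ m₂ l₁ l₂) : Prop where
  feas : (T.x, T.y) ∈ P.feasPlus
  min : IsMinOn (objJoint P p x y lam Hx Hy) P.feasPlus (T.x, T.y)
  stat_x : gradX P p x y lam + calHx P p Hx *ᵥ (T.x - x) + p.β • (P.Aᵀ *ᵥ (P.B *ᵥ (T.y - y)))
    + P.Eᵀ *ᵥ T.mult.μ + P.Cᵀ *ᵥ (T.mult.γx - T.mult.αx) = 0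
  stat_y : gradY P p x y lam + calHy P p Hy *ᵥ (T.y - y) + p.β • (P.Bᵀ *ᵥ (P.A *ᵥ (T.x - x)))
    + P.Fᵀ *ᵥ T.mult.μ + P.Dᵀ *ᵥ (T.mult.γy - T.mult.αy) = 0
  compl : Complementary T.mult.μ (-(P.ineq T.x T.y))
  box_x : BoxCompl P.l P.v (P.C *ᵥ T.x) T.mult.αx T.mult.γx
  box_y : BoxCompl P.s P.r (P.D *ᵥ T.y) T.mult.αy T.mult.γy

end Subproblems

/-- The quantities produced along an infinite run of the method. The entry `joint k` is
meaningful only at iterations where the joint subproblem is solved. -/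
structure Trace (n₁ n₂ m₁ m₂ l₁ l₂ : ℕ) where
  x : ℕ → Fin n₁ → ℝ
  y : ℕ → Fin n₂ → ℝ
  lam : ℕ → Fin m₁ → ℝ
  Hx : ℕ → Matrix (Fin n₁) (Fin n₁) ℝ
  Hy : ℕ → Matrix (Fin n₂) (Fin n₂) ℝ
  split : ℕ → SplitSol n₁ n₂ m₂ l₁ l₂
  joint : ℕ → JointSol n₁ n₂ m₂ l₁ l₂
  t : ℕ → ℝ

namespace Trace

variable {n₁ n₂ m₁ m₂ l₁ l₂ : ℕ} (P : Problem n₁ n₂ m₁ m₂ l₁ l₂) (p : Params)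
  (T : Trace n₁ n₂ m₁ m₂ l₁ l₂)

/-- The iterate `w_k = (x_k, y_k, λ_k)`. -/
def w (k : ℕ) : (Fin n₁ → ℝ) × (Fin n₂ → ℝ) × (Fin m₁ → ℝ) := (T.x k, T.y k, T.lam k)

/-- The recognition criterion: the splitting is accepted at iteration `k`. -/
def Accepted (k : ℕ) : Prop :=
  min (enorm2 (T.split k).μx) (enorm2 (T.split k).μy) ≤ p.M ∧
  enorm2 ((T.split k).μx - (T.split k).μy) ≤
    p.M₁ * (enorm2 (Sum.elim ((T.split k).x - T.x k) ((T.split k).y - T.y k)) ^ p.τ₁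
      + p.M₂ * enorm2 (P.res (T.x k) (T.y k)) ^ p.τ₂)

open Classical in
/-- `x̃_{k+1}`. -/
def xt (k : ℕ) : Fin n₁ → ℝ := if T.Accepted P p k then (T.split k).x else (T.joint k).x

open Classical in
/-- `ỹ_{k+1}`. -/
def yt (k : ℕ) : Fin n₂ → ℝ := if T.Accepted P p k then (T.split k).y else (T.joint k).y

/-- `d^x_k`. -/
def dx (k : ℕ) : Fin n₁ → ℝ := T.xt P p k - T.x k

/-- `d^y_k`. -/
def dy (k : ℕ) : Fin n₂ → ℝ := T.yt P p k - T.y k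

/-- The search direction `d^u_k = (d^x_k, d^y_k)`. -/
def du (k : ℕ) : Fin n₁ ⊕ Fin n₂ → ℝ := Sum.elim (T.dx P p k) (T.dy P p k)

/-- `ℋ^u_k`. -/
def Hu (k : ℕ) : Matrix (Fin n₁ ⊕ Fin n₂) (Fin n₁ ⊕ Fin n₂) ℝ :=
  calHu P p (T.Hx k) (T.Hy k)

/-- `ℋ̂^u_k`. -/
def HuHat (k : ℕ) : Matrix (Fin n₁ ⊕ Fin n₂) (Fin n₁ ⊕ Fin n₂) ℝ :=
  hatHu P p (T.Hx k) (T.Hy k)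

open Classical in
/-- `ℋ̃^u_k`. -/
def HuTilde (k : ℕ) : Matrix (Fin n₁ ⊕ Fin n₂) (Fin n₁ ⊕ Fin n₂) ℝ :=
  if T.Accepted P p k then T.Hu P p k else T.HuHat P p k

open Classical in
/-- `c_max` at iteration `k`. -/
def cmax (k : ℕ) : ℝ := if T.Accepted P p k then 1 / (2 - p.c) else 1

/-- The Armijo condition at iteration `k` for the step size `t`. -/
def Armijo (k : ℕ) (t : ℝ) : Prop :=
  P.augLag p.β (T.x k + t • T.dx P p k) (T.y k + t • T.dy P p k) (T.lam k) ≤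
    P.augLag p.β (T.x k) (T.y k) (T.lam k) - p.ρ * t * qnorm (T.HuTilde P p k) (T.du P p k)

/-- `T` is an infinite (never stopping) run of the method on the problem `P` with
parameters `p`. -/
structure IsRun : Prop where
  start : (T.x 0, T.y 0) ∈ P.feasPlus
  start_Hx : (T.Hx 0).PosDef
  start_Hy : (T.Hy 0).PosDef
  symm_Hx : ∀ k, (T.Hx k).IsSymm
  symm_Hy : ∀ k, (T.Hy k).IsSymm
  posDef_x : ∀ k, (calHx P p (T.Hx k)).PosDef
  posDef_y : ∀ k, (calHy P p (T.Hy k)).PosDef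
  posDef_hat : ∀ k, (T.HuHat P p k).PosDef
  step_split : ∀ k, IsSplitSol P p (T.x k) (T.y k) (T.lam k) (T.Hx k) (T.Hy k) (T.split k)
  step_joint : ∀ k, ¬ T.Accepted P p k →
    IsJointSol P p (T.x k) (T.y k) (T.lam k) (T.Hx k) (T.Hy k) (T.joint k)
  line_search : ∀ k,
    IsGreatest {t : ℝ | (∃ i : ℕ, t = T.cmax P p k * p.σ ^ i) ∧ T.Armijo P p k t} (T.t k)
  next_x : ∀ k, T.x (k + 1) = T.x k + T.t k • T.dx P p k
  next_y : ∀ k, T.y (k + 1) = T.y k + T.t k • T.dy P p k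
  next_lam : ∀ k, T.lam (k + 1) = T.lam k + p.ξ • P.res (T.x (k + 1)) (T.y (k + 1))
  no_stop : ∀ k, ¬ (T.x (k + 1) = T.x k ∧ T.y (k + 1) = T.y k ∧
    P.res (T.x (k + 1)) (T.y (k + 1)) = 0)

/-- The matrices `ℋ^u_k` and `ℋ̂^u_k` are uniformly positive definite, and they are bounded along
every subsequence along which the iterates are bounded (boundedness of matrices is stated
entrywise). -/
def UniformHessians : Prop :=
  (∃ η : ℝ, 0 < η ∧ ∀ k, (T.Hu P p k - η • (1 : Matrix _ _ ℝ)).PosSemidef ∧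
    (T.HuHat P p k - η • (1 : Matrix _ _ ℝ)).PosSemidef) ∧
  ∀ K : Set ℕ, Bornology.IsBounded (T.w '' K) →
    ∃ R : ℝ, ∀ k ∈ K, ∀ i j, |T.Hu P p k i j| ≤ R ∧ |T.HuHat P p k i j| ≤ R

/-- `f` and `θ` are twice continuously differentiable in a neighborhood of `ℱ₊`; the iterates are
bounded; and `(x, y, λ)` is an accumulation point of them at which the linear independence
constraint qualification holds and, for the multipliers that make it a KKT solution, the strong
second-order sufficient condition. -/
structure SecondOrder (x : Fin n₁ → ℝ) (y : Fin n₂ → ℝ) (lam : Fin m₁ → ℝ) : Prop where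
  smooth : ∃ U : Set ((Fin n₁ → ℝ) × (Fin n₂ → ℝ)), IsOpen U ∧ P.feasPlus ⊆ U ∧
    ContDiffOn ℝ 2 (fun u => P.f u.1) U ∧ ContDiffOn ℝ 2 (fun u => P.θ u.2) U
  bounded : Bornology.IsBounded (Set.range T.w)
  accum : MapClusterPt (x, y, lam) atTop T.w
  licq : P.LICQ x y
  ssos : ∀ Λ : Mult m₂ l₁ l₂, P.IsKKT x y lam Λ → P.SSOS x y Λ

open Classical in
/-- The index set `S⁺_k`. -/
def Splus (k : ℕ) : Finset (Fin m₂) :=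
  if T.Accepted P p k then
    (Finset.univ.filter fun i =>
      (P.ineq (T.xt P p k) (T.y k) - (1 / 2 : ℝ) • P.ineq (T.x k) (T.y k)) i = 0) ∩
    (Finset.univ.filter fun i =>
      (P.ineq (T.x k) (T.yt P p k) - (1 / 2 : ℝ) • P.ineq (T.x k) (T.y k)) i = 0)
  else P.actIneq (T.xt P p k) (T.yt P p k)

/-- The matrix `ℬ_k` with rows `(E_{S⁺_k} F_{S⁺_k})`, `(C_{I_k} 0)`, `(0 D_{J_k})`. -/
def calB (k : ℕ) : Matrix (T.Splus P p k ⊕ (P.actX (T.xt P p k) ⊕ P.actY (T.yt P p k)))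
    (Fin n₁ ⊕ Fin n₂) ℝ :=
  P.rowsIneq (T.Splus P p k) (P.actX (T.xt P p k)) (P.actY (T.yt P p k))

/-- The projection `P_k = I - ℬ_kᵀ (ℬ_k ℬ_kᵀ)⁻¹ ℬ_k`. -/
def proj (k : ℕ) : Matrix (Fin n₁ ⊕ Fin n₂) (Fin n₁ ⊕ Fin n₂) ℝ :=
  1 - (T.calB P p k)ᵀ * (T.calB P p k * (T.calB P p k)ᵀ)⁻¹ * T.calB P p k

/-- The error vector `(ℋ^u_k - ∇²_{uu} ℒ_β(w_k)) d^u_k`. -/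
def hessErr (k : ℕ) : Fin n₁ ⊕ Fin n₂ → ℝ :=
  (T.Hu P p k - P.hessAugLag p.β (T.x k) (T.y k) (T.lam k)) *ᵥ T.du P p k

/-- The full second-order approximation condition. -/
def FullApprox : Prop :=
  (fun k => enorm2 (T.hessErr P p k)) =o[atTop] fun k => enorm2 (T.du P p k)

/-- The projected second-order approximation condition. -/
def ProjApprox : Prop :=
  (fun k => enorm2 (T.proj P p k *ᵥ T.hessErr P p k)) =o[atTop] fun k => enorm2 (T.du P p k)

end Trace

end PFDSQO

end

namespace PFDSQO

section Vectors

variable {ι : Type} [Fintype ι]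

theorem enorm2_sq (z : ι → ℝ) : enorm2 z ^ 2 = z ⬝ᵥ z := by
  rw [enorm2, EuclideanSpace.norm_sq_eq]
  simp [dotProduct, sq]

theorem enorm2_nonneg (z : ι → ℝ) : 0 ≤ enorm2 z := norm_nonneg _

theorem norm_sq_le_dotProduct_self (z : ι → ℝ) : ‖z‖ ^ 2 ≤ z ⬝ᵥ z := by
  have h0 : 0 ≤ z ⬝ᵥ z := Finset.sum_nonneg fun i _ => mul_self_nonneg _
  have : ‖z‖ ≤ Real.sqrt (z ⬝ᵥ z) := by
    refine (pi_norm_le_iff_of_nonneg (Real.sqrt_nonneg _)).2 fun i => ?_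
    rw [Real.norm_eq_abs]
    refine Real.abs_le_sqrt ?_
    rw [sq]
    exact Finset.single_le_sum (f := fun i => z i * z i)
      (fun i _ => mul_self_nonneg _) (Finset.mem_univ i)
  calc ‖z‖ ^ 2 ≤ Real.sqrt (z ⬝ᵥ z) ^ 2 := by gcongr
    _ = z ⬝ᵥ z := Real.sq_sqrt h0

theorem norm_le_enorm2 (z : ι → ℝ) : ‖z‖ ≤ enorm2 z := by
  refine le_of_sq_le_sq ?_ (enorm2_nonneg z)
  rw [enorm2_sq]
  exact norm_sq_le_dotProduct_self z

theorem abs_dotProduct_le (a b : ι → ℝ) :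
    |a ⬝ᵥ b| ≤ Fintype.card ι * ‖a‖ * ‖b‖ := by
  calc |a ⬝ᵥ b| ≤ ∑ i, |a i * b i| := Finset.abs_sum_le_sum_abs _ _
    _ ≤ ∑ _i : ι, ‖a‖ * ‖b‖ := by
        refine Finset.sum_le_sum fun i _ => ?_
        rw [abs_mul]
        exact mul_le_mul (norm_le_pi_norm a i) (norm_le_pi_norm b i) (abs_nonneg _) (norm_nonneg _)
    _ = _ := by simp [mul_assoc]

theorem enorm2_le (z : ι → ℝ) : enorm2 z ≤ Fintype.card ι * ‖z‖ := by
  rcases isEmpty_or_nonempty ι with h | h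
  · have : enorm2 z = 0 := by
      have := enorm2_sq z
      simpa [dotProduct] using this
    simp [this]
  refine le_of_sq_le_sq ?_ (by positivity)
  rw [enorm2_sq]
  have h1 : (1 : ℝ) ≤ Fintype.card ι := by exact_mod_cast Fintype.card_pos
  calc z ⬝ᵥ z ≤ |z ⬝ᵥ z| := le_abs_self _
    _ ≤ Fintype.card ι * ‖z‖ * ‖z‖ := abs_dotProduct_le z z
    _ ≤ Fintype.card ι * (Fintype.card ι * ‖z‖ * ‖z‖) :=
        le_mul_of_one_le_left (by positivity) h1
    _ = _ := by ring

theorem enorm2_isTheta {α κ : Type} [Fintype κ] (l : Filter α) (a : α → κ → ℝ) :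
    (fun k => enorm2 (a k)) =Θ[l] fun k => ‖a k‖ := by
  refine ⟨IsBigO.of_bound (Fintype.card κ) (Eventually.of_forall fun k => ?_),
    IsBigO.of_bound 1 (Eventually.of_forall fun k => ?_)⟩
  · rw [Real.norm_of_nonneg (enorm2_nonneg _), norm_norm]
    exact enorm2_le _
  · rw [Real.norm_of_nonneg (enorm2_nonneg _), norm_norm, one_mul]
    exact norm_le_enorm2 _

theorem qnorm_lower [DecidableEq ι] {H : Matrix ι ι ℝ} {η : ℝ} (hη : 0 ≤ η)
    (h : (H - η • (1 : Matrix ι ι ℝ)).PosSemidef) (z : ι → ℝ) : η * ‖z‖ ^ 2 ≤ qnorm H z := by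
  have h1 := h.dotProduct_mulVec_nonneg z
  simp only [star_trivial, Matrix.sub_mulVec, dotProduct_sub, Matrix.smul_mulVec,
    Matrix.one_mulVec, dotProduct_smul, smul_eq_mul, sub_nonneg] at h1
  exact (mul_le_mul_of_nonneg_left (norm_sq_le_dotProduct_self z) hη).trans h1

theorem norm_mulVec_le {κ : Type} [Fintype κ] {H : Matrix κ ι ℝ} {R : ℝ} (hR : 0 ≤ R)
    (h : ∀ i j, |H i j| ≤ R) (z : ι → ℝ) : ‖H *ᵥ z‖ ≤ Fintype.card ι * R * ‖z‖ := by
  refine (pi_norm_le_iff_of_nonneg (by positivity)).2 fun i => ?_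
  refine (abs_dotProduct_le _ _).trans ?_
  gcongr
  exact (pi_norm_le_iff_of_nonneg hR).2 fun j => h i j

end Vectors

section Calculus

theorem abs_taylor_le {W : Type} [NormedAddCommGroup W] [NormedSpace ℝ W] {g : W → ℝ} {u d : W}
    {L : W →L[ℝ] W →L[ℝ] ℝ} {C : ℝ}
    (hg : ∀ s ∈ Set.Icc (0 : ℝ) 1, DifferentiableAt ℝ g (u + s • d))
    (hg' : ∀ s ∈ Set.Icc (0 : ℝ) 1, DifferentiableAt ℝ (fderiv ℝ g) (u + s • d))
    (hC : ∀ s ∈ Set.Icc (0 : ℝ) 1, ‖fderiv ℝ (fderiv ℝ g) (u + s • d) - L‖ ≤ C) :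
    |g (u + d) - g u - fderiv ℝ g u d - 1 / 2 * L d d| ≤ C * ‖d‖ ^ 2 := by
  have hC0 : 0 ≤ C := le_trans (norm_nonneg (fderiv ℝ (fderiv ℝ g) (u + (0 : ℝ) • d) - L))
    (hC 0 (by simp))
  have hline : ∀ s : ℝ, HasDerivAt (fun s : ℝ => u + s • d) d s := fun s => by
    simpa using ((hasDerivAt_id s).smul_const d).const_add u
  have h1 : ∀ s ∈ Set.Icc (0 : ℝ) 1,
      ‖fderiv ℝ g (u + s • d) - fderiv ℝ g u - s • L d‖ ≤ C * ‖d‖ := by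
    intro s hs
    have := norm_image_sub_le_of_norm_deriv_le_segment' (a := (0 : ℝ)) (b := 1)
      (f := fun s : ℝ => fderiv ℝ g (u + s • d) - s • L d)
      (f' := fun s => fderiv ℝ (fderiv ℝ g) (u + s • d) d - L d) (C := C * ‖d‖)
      (fun s hs => by
        have h2 := (hg' s hs).hasFDerivAt.comp_hasDerivAt s (hline s)
        have h3 : HasDerivAt (fun s : ℝ => s • L d) (L d) s := by
          simpa using (hasDerivAt_id s).smul_const (L d)
        exact (h2.sub h3).hasDerivWithinAt)
      (fun s hs => by
        have := (fderiv ℝ (fderiv ℝ g) (u + s • d) - L).le_opNorm d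
        simp only [sub_apply] at this
        exact this.trans (by gcongr; exact hC s ⟨hs.1, hs.2.le⟩)) s hs
    simp only [zero_smul, add_zero, sub_zero] at this
    calc _ = ‖fderiv ℝ g (u + s • d) - s • L d - fderiv ℝ g u‖ := by congr 1; abel
      _ ≤ C * ‖d‖ * s := this
      _ ≤ C * ‖d‖ := mul_le_of_le_one_right (by positivity) hs.2
  have h2 := norm_image_sub_le_of_norm_deriv_le_segment' (a := (0 : ℝ)) (b := 1)
      (f := fun s : ℝ => g (u + s • d) - s * fderiv ℝ g u d - s ^ 2 / 2 * L d d)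
      (f' := fun s => fderiv ℝ g (u + s • d) d - fderiv ℝ g u d - s * L d d) (C := C * ‖d‖ ^ 2)
      (fun s hs => by
        have h2 := (hg s hs).hasFDerivAt.comp_hasDerivAt s (hline s)
        have h3 : HasDerivAt (fun s : ℝ => s * fderiv ℝ g u d) (fderiv ℝ g u d) s := by
          simpa using (hasDerivAt_id s).mul_const (fderiv ℝ g u d)
        have h4 : HasDerivAt (fun s : ℝ => s ^ 2 / 2 * L d d) (s * L d d) s := by
          refine ((((hasDerivAt_id s).fun_pow 2).div_const 2).mul_const (L d d)).congr_deriv ?_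
          simp
        exact ((h2.sub h3).sub h4).hasDerivWithinAt)
      (fun s hs => by
        have h5 := (fderiv ℝ g (u + s • d) - fderiv ℝ g u - s • L d).le_opNorm d
        change ‖fderiv ℝ g (u + s • d) d - fderiv ℝ g u d - s * L d d‖ ≤ _ at h5
        refine h5.trans ?_
        calc _ ≤ C * ‖d‖ * ‖d‖ := by gcongr; exact h1 s ⟨hs.1, hs.2.le⟩
          _ = _ := by ring) 1 (by simp)
  simp only [zero_smul, add_zero, one_smul, zero_mul, sub_zero, one_mul, one_pow, ne_eq,
    OfNat.ofNat_ne_zero, not_false_eq_true, zero_pow, zero_div, mul_one] at h2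
  rw [Real.norm_eq_abs] at h2
  convert h2 using 2
  ring

variable {ι : Type} [Fintype ι] [DecidableEq ι]

theorem sum_smul_single (v : ι → ℝ) : v = ∑ i, v i • (Pi.single i 1 : ι → ℝ) := by
  ext j
  simp [Finset.sum_apply, Pi.single_apply]

theorem fderiv_apply_eq_grad (g : (ι → ℝ) → ℝ) (z v : ι → ℝ) :
    fderiv ℝ g z v = grad g z ⬝ᵥ v := by
  conv_lhs => rw [sum_smul_single v]
  simp [grad, dotProduct, mul_comm]

theorem fderiv_fderiv_apply_eq_hess (g : (ι → ℝ) → ℝ) (z v w : ι → ℝ) :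
    fderiv ℝ (fderiv ℝ g) z v w = v ⬝ᵥ (hess g z *ᵥ w) := by
  conv_lhs => rw [sum_smul_single v, sum_smul_single w]
  simp only [map_sum, map_smul, sum_apply, smul_apply,
    smul_eq_mul, dotProduct, Matrix.mulVec, hess, Matrix.of_apply, Finset.mul_sum]
  rw [Finset.sum_comm]
  exact Finset.sum_congr rfl fun i _ => Finset.sum_congr rfl fun j _ => by ring

theorem abs_hess_le (g : (ι → ℝ) → ℝ) (z : ι → ℝ) (i j : ι) :
    |hess g z i j| ≤ ‖fderiv ℝ (fderiv ℝ g) z‖ := by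
  have h := (fderiv ℝ (fderiv ℝ g) z).le_opNorm₂ (Pi.single i 1) (Pi.single j 1)
  simpa [hess, Pi.norm_single] using h

end Calculus

namespace Problem

variable {n₁ n₂ m₁ m₂ l₁ l₂ : ℕ} (P : Problem n₁ n₂ m₁ m₂ l₁ l₂)

/-- The augmented Lagrangian as a function of the stacked vector. -/
noncomputable def stackLag (β : ℝ) (lam : Fin m₁ → ℝ) (u : Fin n₁ ⊕ Fin n₂ → ℝ) : ℝ :=
  P.augLag β (u ∘ Sum.inl) (u ∘ Sum.inr) lam

/-- The rows of `(A B)` as linear functionals. -/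
noncomputable def eqRow (i : Fin m₁) : (Fin n₁ ⊕ Fin n₂ → ℝ) →L[ℝ] ℝ :=
  LinearMap.toContinuousLinearMap
    ((LinearMap.proj i).comp (Matrix.fromCols P.A P.B).mulVecLin)

theorem eqRow_apply (i : Fin m₁) (u : Fin n₁ ⊕ Fin n₂ → ℝ) :
    P.eqRow i u = (P.A *ᵥ (u ∘ Sum.inl)) i + (P.B *ᵥ (u ∘ Sum.inr)) i := by
  simp [eqRow, Matrix.fromCols_mulVec]

theorem res_apply (u : Fin n₁ ⊕ Fin n₂ → ℝ) (i : Fin m₁) :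
    P.res (u ∘ Sum.inl) (u ∘ Sum.inr) i = P.eqRow i u - P.b i := by
  simp [res, eqRow_apply]

theorem stackLag_eq (β : ℝ) (lam : Fin m₁ → ℝ) (u : Fin n₁ ⊕ Fin n₂ → ℝ) :
    P.stackLag β lam u = P.obj u +
      ∑ i, (β / 2 * (P.eqRow i u - P.b i) ^ 2 - lam i * (P.eqRow i u - P.b i)) := by
  rw [stackLag, augLag, enorm2_sq, obj, Finset.sum_sub_distrib, ← Finset.mul_sum]
  simp only [dotProduct, res_apply, sq]
  ring

theorem obj_contDiff : ContDiff ℝ 1 P.obj := by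
  unfold obj
  refine (P.f_smooth.comp ?_).add (P.θ_smooth.comp ?_) <;>
  · refine contDiff_pi.2 fun i => ?_
    exact contDiff_apply ℝ ℝ _

theorem fderiv_obj_apply (u v : Fin n₁ ⊕ Fin n₂ → ℝ) :
    fderiv ℝ P.obj u v = grad P.f (u ∘ Sum.inl) ⬝ᵥ (v ∘ Sum.inl)
      + grad P.θ (u ∘ Sum.inr) ⬝ᵥ (v ∘ Sum.inr) := by
  let L1 : (Fin n₁ ⊕ Fin n₂ → ℝ) →L[ℝ] (Fin n₁ → ℝ) :=
    ContinuousLinearMap.pi fun i => ContinuousLinearMap.proj (Sum.inl i)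
  let L2 : (Fin n₁ ⊕ Fin n₂ → ℝ) →L[ℝ] (Fin n₂ → ℝ) :=
    ContinuousLinearMap.pi fun i => ContinuousLinearMap.proj (Sum.inr i)
  have h1 : HasFDerivAt (fun u : Fin n₁ ⊕ Fin n₂ → ℝ => P.f (L1 u))
      ((fderiv ℝ P.f (L1 u)).comp L1) u :=
    ((P.f_smooth.differentiable one_ne_zero) (L1 u)).hasFDerivAt.comp u L1.hasFDerivAt
  have h2 : HasFDerivAt (fun u : Fin n₁ ⊕ Fin n₂ → ℝ => P.θ (L2 u))
      ((fderiv ℝ P.θ (L2 u)).comp L2) u :=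
    ((P.θ_smooth.differentiable one_ne_zero) (L2 u)).hasFDerivAt.comp u L2.hasFDerivAt
  have h3 : fderiv ℝ P.obj u = (fderiv ℝ P.f (L1 u)).comp L1 + (fderiv ℝ P.θ (L2 u)).comp L2 :=
    (h1.add h2).fderiv
  rw [h3, add_apply, ContinuousLinearMap.comp_apply,
    ContinuousLinearMap.comp_apply, fderiv_apply_eq_grad, fderiv_apply_eq_grad]
  rfl

theorem hasFDerivAt_stackLag (β : ℝ) (lam : Fin m₁ → ℝ) (u : Fin n₁ ⊕ Fin n₂ → ℝ) :
    HasFDerivAt (P.stackLag β lam)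
      (fderiv ℝ P.obj u + ∑ i, (β * (P.eqRow i u - P.b i) - lam i) • P.eqRow i) u := by
  have h : P.stackLag β lam = fun u => P.obj u +
      ∑ i, (β / 2 * (P.eqRow i u - P.b i) ^ 2 - lam i * (P.eqRow i u - P.b i)) :=
    funext (P.stackLag_eq β lam)
  rw [h]
  refine ((P.obj_contDiff.differentiable one_ne_zero) u).hasFDerivAt.add
    (HasFDerivAt.fun_sum fun i _ => ?_)
  have h1 : HasFDerivAt (fun u => P.eqRow i u - P.b i) (P.eqRow i) u :=
    (P.eqRow i).hasFDerivAt.sub_const _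
  refine (((h1.pow 2).const_mul (β / 2)).sub (h1.const_mul (lam i))).congr_fderiv ?_
  ext v
  simp
  ring

theorem differentiable_stackLag (β : ℝ) (lam : Fin m₁ → ℝ) :
    Differentiable ℝ (P.stackLag β lam) := fun u =>
  (P.hasFDerivAt_stackLag β lam u).differentiableAt

/-- The constant second derivative of the penalty term. -/
noncomputable def penaltyHess (β : ℝ) :
    (Fin n₁ ⊕ Fin n₂ → ℝ) →L[ℝ] (Fin n₁ ⊕ Fin n₂ → ℝ) →L[ℝ] ℝ :=
  ∑ i, (β • P.eqRow i).smulRight (P.eqRow i)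

theorem hasFDerivAt_fderiv_stackLag (β : ℝ) (lam : Fin m₁ → ℝ) {u : Fin n₁ ⊕ Fin n₂ → ℝ}
    (hu : DifferentiableAt ℝ (fderiv ℝ P.obj) u) :
    HasFDerivAt (fderiv ℝ (P.stackLag β lam))
      (fderiv ℝ (fderiv ℝ P.obj) u + P.penaltyHess β) u := by
  have h : fderiv ℝ (P.stackLag β lam) = fun u => fderiv ℝ P.obj u +
      ∑ i, (β * (P.eqRow i u - P.b i) - lam i) • P.eqRow i :=
    funext fun u => (P.hasFDerivAt_stackLag β lam u).fderiv
  rw [h]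
  refine hu.hasFDerivAt.add (HasFDerivAt.fun_sum fun i _ => ?_)
  have h1 : HasFDerivAt (fun u => β * (P.eqRow i u - P.b i) - lam i) (β • P.eqRow i) u :=
    (((P.eqRow i).hasFDerivAt.sub_const _).const_mul β).sub_const _
  exact h1.smul_const (P.eqRow i)

theorem fderiv_stackLag_apply (p : Params) (lam : Fin m₁ → ℝ) (x : Fin n₁ → ℝ) (y : Fin n₂ → ℝ)
    (v : Fin n₁ ⊕ Fin n₂ → ℝ) :
    fderiv ℝ (P.stackLag p.β lam) (Sum.elim x y) v =
      Sum.elim (gradX P p x y lam) (gradY P p x y lam) ⬝ᵥ v := by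
  rw [(P.hasFDerivAt_stackLag p.β lam _).fderiv, add_apply, fderiv_obj_apply]
  have h : (∑ i, (p.β * (P.eqRow i (Sum.elim x y) - P.b i) - lam i) • P.eqRow i) v =
      (p.β • P.res x y - lam) ⬝ᵥ (P.A *ᵥ (v ∘ Sum.inl) + P.B *ᵥ (v ∘ Sum.inr)) := by
    simp only [sum_apply, smul_apply, smul_eq_mul,
      dotProduct]
    refine Finset.sum_congr rfl fun i _ => ?_
    have := P.res_apply (Sum.elim x y) i
    simp only [Sum.elim_comp_inl, Sum.elim_comp_inr] at this
    rw [← this, eqRow_apply]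
    simp
  rw [h]
  have hv : v = Sum.elim (v ∘ Sum.inl) (v ∘ Sum.inr) := (Sum.elim_comp_inl_inr v).symm
  conv_rhs => rw [hv, sumElim_dotProduct_sumElim]
  simp only [gradX, gradY, sub_dotProduct, dotProduct_add, Matrix.dotProduct_mulVec,
    Matrix.mulVec_transpose, Sum.elim_comp_inl, Sum.elim_comp_inr, Matrix.sub_vecMul]
  ring

theorem exists_open_smooth (U : Set ((Fin n₁ → ℝ) × (Fin n₂ → ℝ))) (hU : IsOpen U)
    (hf : ContDiffOn ℝ 2 (fun u => P.f u.1) U) (hθ : ContDiffOn ℝ 2 (fun u => P.θ u.2) U) :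
    IsOpen {u : Fin n₁ ⊕ Fin n₂ → ℝ | (u ∘ Sum.inl, u ∘ Sum.inr) ∈ U} ∧
    ∀ u : Fin n₁ ⊕ Fin n₂ → ℝ, (u ∘ Sum.inl, u ∘ Sum.inr) ∈ U → ContDiffAt ℝ 2 P.obj u := by
  let L1 : (Fin n₁ ⊕ Fin n₂ → ℝ) →L[ℝ] (Fin n₁ → ℝ) :=
    ContinuousLinearMap.pi fun i => ContinuousLinearMap.proj (Sum.inl i)
  let L2 : (Fin n₁ ⊕ Fin n₂ → ℝ) →L[ℝ] (Fin n₂ → ℝ) :=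
    ContinuousLinearMap.pi fun i => ContinuousLinearMap.proj (Sum.inr i)
  refine ⟨hU.preimage (L1.prod L2).continuous, fun u hu => ?_⟩
  have h1 := (hf.contDiffAt (hU.mem_nhds hu)).comp u (L1.prod L2).contDiff.contDiffAt
  have h2 := (hθ.contDiffAt (hU.mem_nhds hu)).comp u (L1.prod L2).contDiff.contDiffAt
  exact h1.add h2

end Problem

section Box

variable {ι : Type} {lo hi : ι → EReal} {z α γ : ι → ℝ}

theorem eq_lower_of_mul_sub_eq_zero {a z : ℝ} {l : EReal} (ha : a ≠ 0) (hl : l ≤ (z : EReal))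
    (h : (a : EReal) * ((z : EReal) - l) = 0) : (z : EReal) = l := by
  rcases mul_eq_zero.1 h with h | h
  · exact absurd (EReal.coe_eq_zero.1 h) ha
  · induction l with
    | bot => simp at h
    | top => simp at hl
    | coe l =>
      rw [← EReal.coe_sub] at h
      rw [sub_eq_zero.1 (EReal.coe_eq_zero.1 h)]

theorem eq_upper_of_mul_sub_eq_zero {a z : ℝ} {l : EReal} (ha : a ≠ 0) (hl : (z : EReal) ≤ l)
    (h : (a : EReal) * (l - (z : EReal)) = 0) : (z : EReal) = l := by
  rcases mul_eq_zero.1 h with h | h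
  · exact absurd (EReal.coe_eq_zero.1 h) ha
  · induction l with
    | bot => simp at hl
    | top => simp at h
    | coe l =>
      rw [← EReal.coe_sub] at h
      rw [sub_eq_zero.1 (EReal.coe_eq_zero.1 h)]

theorem BoxCompl.eq_lo (h : BoxCompl lo hi z α γ) {i : ι} (hneg : γ i - α i < 0) :
    (z i : EReal) = lo i := by
  have h1 := (h i).1
  have h2 := (h i).2.1
  exact eq_lower_of_mul_sub_eq_zero (by linarith : 0 < α i).ne' h1.2.1 h1.2.2

theorem BoxCompl.eq_hi (h : BoxCompl lo hi z α γ) {i : ι} (hpos : 0 < γ i - α i) :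
    (z i : EReal) = hi i := by
  have h1 := (h i).2
  have h2 := (h i).1.1
  exact eq_upper_of_mul_sub_eq_zero (by linarith : 0 < γ i).ne' h1.2.1 h1.2.2

theorem BoxCompl.mul_sub_eq (h : BoxCompl lo hi z α γ) {i : ι} {z₀ : ℝ} (h1 : lo i ≤ z₀)
    (h2 : z₀ ≤ hi i) : (γ i - α i) * (z i - z₀) = |γ i - α i| * |z i - z₀| := by
  rcases lt_trichotomy (γ i - α i) 0 with h3 | h3 | h3
  · have : z i ≤ z₀ := by
      rw [← h.eq_lo h3] at h1
      exact_mod_cast h1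
    rw [abs_of_neg h3, abs_of_nonpos (by linarith)]
    ring
  · simp [h3]
  · have : z₀ ≤ z i := by
      rw [← h.eq_hi h3] at h2
      exact_mod_cast h2
    rw [abs_of_pos h3, abs_of_nonneg (by linarith)]

theorem convex_box (lo hi : EReal) : Convex ℝ {z : ℝ | lo ≤ (z : EReal) ∧ (z : EReal) ≤ hi} := by
  refine Set.OrdConnected.convex ⟨fun a ha b hb z hz => ⟨?_, ?_⟩⟩
  · exact ha.1.trans (by exact_mod_cast hz.1)
  · exact le_trans (by exact_mod_cast hz.2) hb.2

theorem isClosed_box (lo hi : EReal) :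
    IsClosed {z : ℝ | lo ≤ (z : EReal) ∧ (z : EReal) ≤ hi} :=
  (isClosed_le continuous_const continuous_coe_real_ereal).inter
    (isClosed_le continuous_coe_real_ereal continuous_const)

end Box

namespace Problem

variable {n₁ n₂ m₁ m₂ l₁ l₂ : ℕ} (P : Problem n₁ n₂ m₁ m₂ l₁ l₂)

/-- The set `ℱ₊` in terms of stacked vectors. -/
def feasStack : Set (Fin n₁ ⊕ Fin n₂ → ℝ) :=
  {u | (u ∘ Sum.inl, u ∘ Sum.inr) ∈ P.feasPlus}

theorem feasStack_eq : P.feasStack =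
    (⋂ i, {u | (P.C *ᵥ (u ∘ Sum.inl)) i ∈ {z : ℝ | P.l i ≤ (z : EReal) ∧ (z : EReal) ≤ P.v i}}) ∩
    ((⋂ j, {u | (P.D *ᵥ (u ∘ Sum.inr)) j ∈ {z : ℝ | P.s j ≤ (z : EReal) ∧ (z : EReal) ≤ P.r j}}) ∩
    ⋂ i, {u | P.ineq (u ∘ Sum.inl) (u ∘ Sum.inr) i ≤ 0}) := by
  ext u
  simp [feasStack, feasPlus, setX, setY, Pi.le_def]

theorem convex_feasStack : Convex ℝ P.feasStack := by
  rw [feasStack_eq]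
  refine (convex_iInter fun i => ?_).inter ((convex_iInter fun j => ?_).inter
    (convex_iInter fun i => ?_))
  · refine (convex_box (P.l i) (P.v i)).is_linear_preimage
      (f := fun u : Fin n₁ ⊕ Fin n₂ → ℝ => (P.C *ᵥ (u ∘ Sum.inl)) i) ⟨fun u v => ?_, fun c u => ?_⟩
    · exact congrFun (P.C.mulVec_add (u ∘ Sum.inl) (v ∘ Sum.inl)) i
    · exact congrFun (P.C.mulVec_smul c (u ∘ Sum.inl)) i
  · refine (convex_box (P.s j) (P.r j)).is_linear_preimage
      (f := fun u : Fin n₁ ⊕ Fin n₂ → ℝ => (P.D *ᵥ (u ∘ Sum.inr)) j) ⟨fun u v => ?_, fun c u => ?_⟩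
    · exact congrFun (P.D.mulVec_add (u ∘ Sum.inr) (v ∘ Sum.inr)) j
    · exact congrFun (P.D.mulVec_smul c (u ∘ Sum.inr)) j
  · have : {u : Fin n₁ ⊕ Fin n₂ → ℝ | P.ineq (u ∘ Sum.inl) (u ∘ Sum.inr) i ≤ 0} =
        {u | (P.E *ᵥ (u ∘ Sum.inl)) i + (P.F *ᵥ (u ∘ Sum.inr)) i ≤ P.d i} := by
      ext u
      simp [ineq]
    rw [this]
    refine convex_halfSpace_le ⟨fun u v => ?_, fun c u => ?_⟩ _
    · have h1 := congrFun (P.E.mulVec_add (u ∘ Sum.inl) (v ∘ Sum.inl)) i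
      have h2 := congrFun (P.F.mulVec_add (u ∘ Sum.inr) (v ∘ Sum.inr)) i
      simp only [Pi.add_apply] at h1 h2
      change (P.E *ᵥ (u ∘ Sum.inl + v ∘ Sum.inl)) i + (P.F *ᵥ (u ∘ Sum.inr + v ∘ Sum.inr)) i = _
      rw [h1, h2]
      ring
    · have h1 := congrFun (P.E.mulVec_smul c (u ∘ Sum.inl)) i
      have h2 := congrFun (P.F.mulVec_smul c (u ∘ Sum.inr)) i
      simp only [Pi.smul_apply, smul_eq_mul] at h1 h2
      change (P.E *ᵥ (c • (u ∘ Sum.inl))) i + (P.F *ᵥ (c • (u ∘ Sum.inr))) i = _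
      rw [h1, h2, smul_eq_mul]
      ring

theorem continuous_mulVec_inl {κ : Type} [Fintype κ] (C : Matrix κ (Fin n₁) ℝ) :
    Continuous fun u : Fin n₁ ⊕ Fin n₂ → ℝ => C *ᵥ (u ∘ Sum.inl) :=
  Continuous.matrix_mulVec continuous_const (continuous_pi fun _ => continuous_apply _)

theorem continuous_mulVec_inr {κ : Type} [Fintype κ] (C : Matrix κ (Fin n₂) ℝ) :
    Continuous fun u : Fin n₁ ⊕ Fin n₂ → ℝ => C *ᵥ (u ∘ Sum.inr) :=
  Continuous.matrix_mulVec continuous_const (continuous_pi fun _ => continuous_apply _)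

theorem isClosed_feasStack : IsClosed P.feasStack := by
  rw [feasStack_eq]
  refine (isClosed_iInter fun i => ?_).inter ((isClosed_iInter fun j => ?_).inter
    (isClosed_iInter fun i => ?_))
  · exact (isClosed_box (P.l i) (P.v i)).preimage
      ((continuous_apply i).comp (continuous_mulVec_inl P.C))
  · exact (isClosed_box (P.s j) (P.r j)).preimage
      ((continuous_apply j).comp (continuous_mulVec_inr P.D))
  · exact isClosed_le ((continuous_apply i).comp (((continuous_mulVec_inl P.E).add
      (continuous_mulVec_inr P.F)).sub continuous_const)) continuous_const

end Problem

namespace Trace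

variable {n₁ n₂ m₁ m₂ l₁ l₂ : ℕ} (P : Problem n₁ n₂ m₁ m₂ l₁ l₂) (p : Params)
  (T : Trace n₁ n₂ m₁ m₂ l₁ l₂)

open Classical in
/-- The subproblem solution used at iteration `k`; the multiplier of the joint inequality
constraint is duplicated. -/
noncomputable def sol (k : ℕ) : SplitSol n₁ n₂ m₂ l₁ l₂ :=
  if T.Accepted P p k then T.split k
  else ⟨(T.joint k).x, (T.joint k).y, (T.joint k).mult.μ, (T.joint k).mult.αx,
    (T.joint k).mult.γx, (T.joint k).mult.μ, (T.joint k).mult.αy, (T.joint k).mult.γy⟩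

/-- The current stacked iterate. -/
def u (k : ℕ) : Fin n₁ ⊕ Fin n₂ → ℝ := Sum.elim (T.x k) (T.y k)

/-- The stacked gradient of the augmented Lagrangian at the current iterate. -/
noncomputable def g (k : ℕ) : Fin n₁ ⊕ Fin n₂ → ℝ :=
  Sum.elim (gradX P p (T.x k) (T.y k) (T.lam k)) (gradY P p (T.x k) (T.y k) (T.lam k))

/-- The signed multiplier `γ^x - α^x`. -/
noncomputable def nuX (k : ℕ) : Fin l₁ → ℝ := (T.sol P p k).γx - (T.sol P p k).αx

/-- The signed multiplier `γ^y - α^y`. -/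
noncomputable def nuY (k : ℕ) : Fin l₂ → ℝ := (T.sol P p k).γy - (T.sol P p k).αy

/-- The properties shared by the split and the joint subproblem solutions. -/
structure IsStep (k : ℕ) : Prop where
  feas : (T.xt P p k, T.yt P p k) ∈ P.feasPlus
  stat_x : gradX P p (T.x k) (T.y k) (T.lam k) + calHx P p (T.Hx k) *ᵥ T.dx P p k
    + P.Eᵀ *ᵥ (T.sol P p k).μx + P.Cᵀ *ᵥ T.nuX P p k = 0
  stat_y : gradY P p (T.x k) (T.y k) (T.lam k) + calHy P p (T.Hy k) *ᵥ T.dy P p k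
    + P.Fᵀ *ᵥ (T.sol P p k).μy + P.Dᵀ *ᵥ T.nuY P p k = 0
  μx_nonneg : ∀ i, 0 ≤ (T.sol P p k).μx i
  μy_nonneg : ∀ i, 0 ≤ (T.sol P p k).μy i
  compl : ∀ i, (T.sol P p k).μx i * (P.E *ᵥ T.dx P p k) i
    + (T.sol P p k).μy i * (P.F *ᵥ T.dy P p k) i =
      -(((T.sol P p k).μx i + (T.sol P p k).μy i) / 2 * P.ineq (T.x k) (T.y k) i)
  suppx : ∀ i, (T.sol P p k).μx i ≠ 0 → |P.ineq (T.x k) (T.y k) i| ≤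
    2 * (|(P.E *ᵥ T.dx P p k) i| + |(P.F *ᵥ T.dy P p k) i|)
  suppy : ∀ i, (T.sol P p k).μy i ≠ 0 → |P.ineq (T.x k) (T.y k) i| ≤
    2 * (|(P.E *ᵥ T.dx P p k) i| + |(P.F *ᵥ T.dy P p k) i|)
  splus : ∀ i ∈ T.Splus P p k,
    (P.E *ᵥ T.dx P p k) i + (P.F *ᵥ T.dy P p k) i = -P.ineq (T.x k) (T.y k) i
  boxX : BoxCompl P.l P.v (P.C *ᵥ T.xt P p k) (T.sol P p k).αx (T.sol P p k).γx
  boxY : BoxCompl P.s P.r (P.D *ᵥ T.yt P p k) (T.sol P p k).αy (T.sol P p k).γy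
  diff : ‖(T.sol P p k).μx - (T.sol P p k).μy‖ ≤
    p.M₁ * (enorm2 (T.du P p k) ^ p.τ₁ + p.M₂ * enorm2 (P.res (T.x k) (T.y k)) ^ p.τ₂)

variable {P p T}

theorem IsRun.isStep (hT : T.IsRun P p) (hc : p.c = 1) (hAB : P.Aᵀ * P.B = 0) (k : ℕ) :
    T.IsStep P p k := by
  have hE : ∀ i, P.ineq (T.xt P p k) (T.y k) i =
      P.ineq (T.x k) (T.y k) i + (P.E *ᵥ T.dx P p k) i := fun i => by
    simp only [dx, Problem.ineq, Matrix.mulVec_sub, Pi.add_apply, Pi.sub_apply]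
    ring
  have hF : ∀ i, P.ineq (T.x k) (T.yt P p k) i =
      P.ineq (T.x k) (T.y k) i + (P.F *ᵥ T.dy P p k) i := fun i => by
    simp only [dy, Problem.ineq, Matrix.mulVec_sub, Pi.add_apply, Pi.sub_apply]
    ring
  have hEF : ∀ i, P.ineq (T.xt P p k) (T.yt P p k) i =
      P.ineq (T.x k) (T.y k) i + (P.E *ᵥ T.dx P p k) i + (P.F *ᵥ T.dy P p k) i := fun i => by
    simp only [dx, dy, Problem.ineq, Matrix.mulVec_sub, Pi.add_apply, Pi.sub_apply]
    ring
  by_cases hA : T.Accepted P p k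
  · have hs := hT.step_split k
    have hsol : T.sol P p k = T.split k := if_pos hA
    have hx : T.xt P p k = (T.split k).x := if_pos hA
    have hy : T.yt P p k = (T.split k).y := if_pos hA
    have hcx : ∀ i, 0 ≤ (T.split k).μx i ∧
        P.ineq (T.x k) (T.y k) i / 2 + (P.E *ᵥ T.dx P p k) i ≤ 0 ∧
        (T.split k).μx i * (P.ineq (T.x k) (T.y k) i / 2 + (P.E *ᵥ T.dx P p k) i) = 0 := by
      intro i
      obtain ⟨h1, h2, h3⟩ := hs.compl_x i
      simp only [← hx, hc, Pi.sub_apply, Pi.smul_apply, smul_eq_mul, hE] at h2 h3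
      exact ⟨h1, by linarith, by linarith⟩
    have hcy : ∀ i, 0 ≤ (T.split k).μy i ∧
        P.ineq (T.x k) (T.y k) i / 2 + (P.F *ᵥ T.dy P p k) i ≤ 0 ∧
        (T.split k).μy i * (P.ineq (T.x k) (T.y k) i / 2 + (P.F *ᵥ T.dy P p k) i) = 0 := by
      intro i
      obtain ⟨h1, h2, h3⟩ := hs.compl_y i
      simp only [← hy, hc, Pi.sub_apply, Pi.smul_apply, smul_eq_mul, hF] at h2 h3
      exact ⟨h1, by linarith, by linarith⟩
    constructor
    · refine ⟨?_, ?_, fun i => ?_⟩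
      · rw [hx]; exact hs.feas_x.1
      · rw [hy]; exact hs.feas_y.1
      · change P.ineq (T.xt P p k) (T.yt P p k) i ≤ 0
        rw [hEF]
        linarith [(hcx i).2.1, (hcy i).2.1]
    · simpa only [dx, nuX, hsol, hx] using hs.stat_x
    · simpa only [dy, nuY, hsol, hy] using hs.stat_y
    · rw [hsol]; exact fun i => (hcx i).1
    · rw [hsol]; exact fun i => (hcy i).1
    · rw [hsol]
      intro i
      linarith [(hcx i).2.2, (hcy i).2.2]
    · rw [hsol]
      intro i hi
      have := (mul_eq_zero.1 (hcx i).2.2).resolve_left hi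
      have h2 : P.ineq (T.x k) (T.y k) i = -2 * (P.E *ᵥ T.dx P p k) i := by linarith
      rw [h2, abs_mul]
      norm_num
    · rw [hsol]
      intro i hi
      have := (mul_eq_zero.1 (hcy i).2.2).resolve_left hi
      have h2 : P.ineq (T.x k) (T.y k) i = -2 * (P.F *ᵥ T.dy P p k) i := by linarith
      rw [h2, abs_mul]
      norm_num
    · intro i hi
      simp only [Splus, if_pos hA, Finset.mem_inter, Finset.mem_filter, Finset.mem_univ, true_and,
        Pi.sub_apply, Pi.smul_apply, smul_eq_mul, hE, hF] at hi
      linarith [hi.1, hi.2]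
    · rw [hsol, hx]; exact hs.box_x
    · rw [hsol, hy]; exact hs.box_y
    · rw [hsol]
      have := (norm_le_enorm2 _).trans hA.2
      simpa only [du, dx, dy, hx, hy] using this
  · have hs := hT.step_joint k hA
    have hsol : T.sol P p k = _ := if_neg hA
    have hx : T.xt P p k = (T.joint k).x := if_neg hA
    have hy : T.yt P p k = (T.joint k).y := if_neg hA
    have hBA : P.Bᵀ * P.A = 0 := by
      simpa [Matrix.transpose_mul] using congrArg Matrix.transpose hAB
    have hcm : ∀ i, 0 ≤ (T.joint k).mult.μ i ∧ (T.joint k).mult.μ i *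
        (P.ineq (T.x k) (T.y k) i + (P.E *ᵥ T.dx P p k) i + (P.F *ᵥ T.dy P p k) i) = 0 := by
      intro i
      obtain ⟨h1, h2, h3⟩ := hs.compl i
      simp only [← hx, ← hy, Pi.neg_apply, hEF] at h2 h3
      exact ⟨h1, by linarith⟩
    have hsupp : ∀ i, (T.joint k).mult.μ i ≠ 0 → |P.ineq (T.x k) (T.y k) i| ≤
        2 * (|(P.E *ᵥ T.dx P p k) i| + |(P.F *ᵥ T.dy P p k) i|) := by
      intro i hi
      have := (mul_eq_zero.1 (hcm i).2).resolve_left hi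
      have h2 : P.ineq (T.x k) (T.y k) i =
        -((P.E *ᵥ T.dx P p k) i + (P.F *ᵥ T.dy P p k) i) := by linarith
      rw [h2, abs_neg]
      linarith [abs_add_le ((P.E *ᵥ T.dx P p k) i) ((P.F *ᵥ T.dy P p k) i),
        abs_nonneg ((P.E *ᵥ T.dx P p k) i), abs_nonneg ((P.F *ᵥ T.dy P p k) i)]
    constructor
    · rw [hx, hy]; exact hs.feas
    · have := hs.stat_x
      rw [Matrix.mulVec_mulVec, hAB, Matrix.zero_mulVec, smul_zero, add_zero] at this
      simpa only [dx, nuX, hsol, hx] using this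
    · have := hs.stat_y
      rw [Matrix.mulVec_mulVec, hBA, Matrix.zero_mulVec, smul_zero, add_zero] at this
      simpa only [dy, nuY, hsol, hy] using this
    · rw [hsol]; exact fun i => (hcm i).1
    · rw [hsol]; exact fun i => (hcm i).1
    · rw [hsol]
      intro i
      linarith [(hcm i).2]
    · rw [hsol]; exact hsupp
    · rw [hsol]; exact hsupp
    · intro i hi
      simp only [Splus, if_neg hA, Problem.actIneq, Finset.mem_filter, Finset.mem_univ, true_and,
        hEF] at hi
      linarith
    · rw [hsol, hx]; exact hs.box_x
    · rw [hsol, hy]; exact hs.box_y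
    · rw [hsol]
      simp only [sub_self, norm_zero]
      exact mul_nonneg p.M₁_pos.le (add_nonneg (Real.rpow_nonneg (enorm2_nonneg _) _)
        (mul_nonneg p.M₂_nonneg (Real.rpow_nonneg (enorm2_nonneg _) _)))

theorem hatHu_eq (hAB : P.Aᵀ * P.B = 0) (k : ℕ) : T.HuHat P p k = T.Hu P p k := by
  have hBA : P.Bᵀ * P.A = 0 := by
    simpa [Matrix.transpose_mul] using congrArg Matrix.transpose hAB
  simp [HuHat, Hu, hatHu, calHu, hAB, hBA]

theorem HuTilde_eq (hAB : P.Aᵀ * P.B = 0) (k : ℕ) : T.HuTilde P p k = T.Hu P p k := by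
  unfold HuTilde
  split_ifs
  · rfl
  · exact hatHu_eq hAB k

theorem cmax_eq_one (hc : p.c = 1) (k : ℕ) : T.cmax P p k = 1 := by
  unfold cmax
  split_ifs
  · rw [hc]; norm_num
  · rfl

theorem IsRun.t_eq_pow (hT : T.IsRun P p) (hc : p.c = 1) (k : ℕ) : ∃ i : ℕ, T.t k = p.σ ^ i := by
  obtain ⟨i, hi⟩ := (hT.line_search k).1.1
  exact ⟨i, by rw [hi, cmax_eq_one hc, one_mul]⟩

theorem IsRun.pow_le_t (hT : T.IsRun P p) (hc : p.c = 1) {k i : ℕ} (h : T.Armijo P p k (p.σ ^ i)) :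
    p.σ ^ i ≤ T.t k :=
  (hT.line_search k).2 ⟨⟨i, by rw [cmax_eq_one hc, one_mul]⟩, h⟩

theorem IsRun.t_pos (hT : T.IsRun P p) (hc : p.c = 1) (k : ℕ) : 0 < T.t k := by
  obtain ⟨i, hi⟩ := hT.t_eq_pow hc k
  rw [hi]
  exact pow_pos p.σ_mem.1 i

theorem IsRun.t_le_one (hT : T.IsRun P p) (hc : p.c = 1) (k : ℕ) : T.t k ≤ 1 := by
  obtain ⟨i, hi⟩ := hT.t_eq_pow hc k
  rw [hi]
  exact pow_le_one₀ p.σ_mem.1.le p.σ_mem.2.le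

theorem u_add_du (k : ℕ) : T.u k + T.du P p k = Sum.elim (T.xt P p k) (T.yt P p k) := by
  ext (i | i) <;> simp [u, du, dx, dy]

theorem IsRun.u_succ (hT : T.IsRun P p) (k : ℕ) :
    T.u (k + 1) = T.u k + T.t k • T.du P p k := by
  ext (i | i) <;> simp [u, du, hT.next_x, hT.next_y]

theorem IsRun.u_add_du_mem (hT : T.IsRun P p) (hc : p.c = 1) (hAB : P.Aᵀ * P.B = 0) (k : ℕ) :
    T.u k + T.du P p k ∈ P.feasStack := by
  rw [u_add_du]
  exact (hT.isStep hc hAB k).feas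

theorem IsRun.u_mem (hT : T.IsRun P p) (hc : p.c = 1) (hAB : P.Aᵀ * P.B = 0) (k : ℕ) :
    T.u k ∈ P.feasStack := by
  induction k with
  | zero => exact hT.start
  | succ k ih =>
    rw [hT.u_succ]
    exact P.convex_feasStack.add_smul_mem ih (hT.u_add_du_mem hc hAB k)
      ⟨(hT.t_pos hc k).le, hT.t_le_one hc k⟩

theorem armijo_iff (hAB : P.Aᵀ * P.B = 0) (k : ℕ) (t : ℝ) : T.Armijo P p k t ↔
    P.stackLag p.β (T.lam k) (T.u k + t • T.du P p k) ≤ P.stackLag p.β (T.lam k) (T.u k)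
      - p.ρ * t * qnorm (T.Hu P p k) (T.du P p k) := by
  rw [Armijo, HuTilde_eq hAB]
  rfl

/-- The decrease contributed by the multipliers. -/
noncomputable def multTerm (P : Problem n₁ n₂ m₁ m₂ l₁ l₂) (p : Params)
    (T : Trace n₁ n₂ m₁ m₂ l₁ l₂) (k : ℕ) : ℝ :=
  ∑ i, ((T.sol P p k).μx i + (T.sol P p k).μy i) / 2 * |P.ineq (T.x k) (T.y k) i|
    + ∑ i, |T.nuX P p k i| * |(P.C *ᵥ T.dx P p k) i|
    + ∑ j, |T.nuY P p k j| * |(P.D *ᵥ T.dy P p k) j|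

theorem IsRun.g_dotProduct_du (hT : T.IsRun P p) (hc : p.c = 1) (hAB : P.Aᵀ * P.B = 0) (k : ℕ) :
    T.g P p k ⬝ᵥ T.du P p k = -qnorm (T.Hu P p k) (T.du P p k) - multTerm P p T k := by
  have hs := hT.isStep hc hAB k
  have hu := hT.u_mem hc hAB k
  have h1 : gradX P p (T.x k) (T.y k) (T.lam k) ⬝ᵥ T.dx P p k =
      -(T.dx P p k ⬝ᵥ (calHx P p (T.Hx k) *ᵥ T.dx P p k)) -
      (T.sol P p k).μx ⬝ᵥ (P.E *ᵥ T.dx P p k) - T.nuX P p k ⬝ᵥ (P.C *ᵥ T.dx P p k) := by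
    have := congrArg (· ⬝ᵥ T.dx P p k) hs.stat_x
    simp only [add_dotProduct, zero_dotProduct, Matrix.mulVec_transpose,
      ← Matrix.dotProduct_mulVec] at this
    rw [dotProduct_comm (T.dx P p k)]
    linarith
  have h2 : gradY P p (T.x k) (T.y k) (T.lam k) ⬝ᵥ T.dy P p k =
      -(T.dy P p k ⬝ᵥ (calHy P p (T.Hy k) *ᵥ T.dy P p k)) -
      (T.sol P p k).μy ⬝ᵥ (P.F *ᵥ T.dy P p k) - T.nuY P p k ⬝ᵥ (P.D *ᵥ T.dy P p k) := by
    have := congrArg (· ⬝ᵥ T.dy P p k) hs.stat_y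
    simp only [add_dotProduct, zero_dotProduct, Matrix.mulVec_transpose,
      ← Matrix.dotProduct_mulVec] at this
    rw [dotProduct_comm (T.dy P p k)]
    linarith
  have h3 : (T.sol P p k).μx ⬝ᵥ (P.E *ᵥ T.dx P p k) + (T.sol P p k).μy ⬝ᵥ (P.F *ᵥ T.dy P p k) =
      ∑ i, ((T.sol P p k).μx i + (T.sol P p k).μy i) / 2 * |P.ineq (T.x k) (T.y k) i| := by
    simp only [dotProduct]
    rw [← Finset.sum_add_distrib]
    refine Finset.sum_congr rfl fun i _ => ?_
    have h0 : P.ineq (T.x k) (T.y k) i ≤ 0 := hu.2.2 i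
    rw [hs.compl i, abs_of_nonpos h0]
    ring
  have h4 : T.nuX P p k ⬝ᵥ (P.C *ᵥ T.dx P p k) =
      ∑ i, |T.nuX P p k i| * |(P.C *ᵥ T.dx P p k) i| := by
    refine Finset.sum_congr rfl fun i _ => ?_
    have := hs.boxX.mul_sub_eq (i := i) (hu.1 i).1 (hu.1 i).2
    simpa only [dx, Matrix.mulVec_sub, Pi.sub_apply, nuX, u, Sum.elim_comp_inl] using this
  have h5 : T.nuY P p k ⬝ᵥ (P.D *ᵥ T.dy P p k) =
      ∑ i, |T.nuY P p k i| * |(P.D *ᵥ T.dy P p k) i| := by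
    refine Finset.sum_congr rfl fun i _ => ?_
    have := hs.boxY.mul_sub_eq (i := i) (hu.2.1 i).1 (hu.2.1 i).2
    simpa only [dy, Matrix.mulVec_sub, Pi.sub_apply, nuY, u, Sum.elim_comp_inr] using this
  have h6 : qnorm (T.Hu P p k) (T.du P p k) =
      T.dx P p k ⬝ᵥ (calHx P p (T.Hx k) *ᵥ T.dx P p k) +
      T.dy P p k ⬝ᵥ (calHy P p (T.Hy k) *ᵥ T.dy P p k) := by
    simp only [qnorm, Hu, calHu, du, Matrix.fromBlocks_mulVec, Sum.elim_comp_inl,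
      Sum.elim_comp_inr, Matrix.zero_mulVec, add_zero, zero_add, sumElim_dotProduct_sumElim]
  rw [multTerm, g, du, sumElim_dotProduct_sumElim, h1, h2, ← h3, ← h4, ← h5]
  rw [du] at h6
  rw [h6]
  ring

theorem IsRun.multTerm_nonneg (hT : T.IsRun P p) (hc : p.c = 1) (hAB : P.Aᵀ * P.B = 0) (k : ℕ) :
    0 ≤ multTerm P p T k := by
  have hs := hT.isStep hc hAB k
  refine add_nonneg (add_nonneg ?_ ?_) ?_ <;> refine Finset.sum_nonneg fun i _ => ?_
  · have := hs.μx_nonneg i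
    have := hs.μy_nonneg i
    positivity
  · positivity
  · positivity

end Trace

theorem tendsto_sub_succ_of_antitone {L : ℕ → ℝ} (hL : Antitone L) {b : ℝ} (hb : ∀ k, b ≤ L k) :
    Tendsto (fun k => L k - L (k + 1)) atTop (𝓝 0) := by
  have h := tendsto_atTop_ciInf hL ⟨b, by rintro _ ⟨k, rfl⟩; exact hb k⟩
  simpa using h.sub (h.comp (tendsto_add_atTop_nat 1))

theorem exists_norm_add_le {W Y : Type} [NormedAddCommGroup W] [NormedAddCommGroup Y] {K : Set W}
    (hK : IsCompact K) {G : W → Y} (hG : ContinuousOn G K)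
    (Q : Y) : ∃ C, ∀ z ∈ K, ‖G z + Q - 0‖ ≤ C := by
  simp only [sub_zero]
  exact hK.exists_bound_of_continuousOn (hG.add continuousOn_const)

theorem exists_norm_add_sub_add_le {W Y : Type} [NormedAddCommGroup W] [NormedAddCommGroup Y] {K : Set W}
    (hK : IsCompact K) {G : W → Y} (hG : ContinuousOn G K)
    (Q : Y) {ε : ℝ} (hε : 0 < ε) :
    ∃ δ, 0 < δ ∧ ∀ z ∈ K, ∀ z' ∈ K, ‖z - z'‖ < δ → ‖G z + Q - (G z' + Q)‖ ≤ ε := by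
  have huc := hK.uniformContinuousOn_of_continuous hG
  obtain ⟨δ, hδ, hδε⟩ := Metric.uniformContinuousOn_iff.1 huc ε hε
  refine ⟨δ, hδ, fun z hz z' hz' hzz => ?_⟩
  rw [add_sub_add_right_eq_sub, ← dist_eq_norm]
  exact (hδε z hz z' hz' (by rwa [dist_eq_norm])).le

theorem continuous_grad {ι : Type} [Fintype ι] [DecidableEq ι] {g : (ι → ℝ) → ℝ}
    (hg : ContDiff ℝ 1 g) : Continuous (grad g) :=
  continuous_pi fun _ => (hg.continuous_fderiv one_ne_zero).clm_apply continuous_const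

namespace Problem

variable {n₁ n₂ m₁ m₂ l₁ l₂ : ℕ} (P : Problem n₁ n₂ m₁ m₂ l₁ l₂)

theorem continuous_res : Continuous
    fun w : (Fin n₁ → ℝ) × (Fin n₂ → ℝ) × (Fin m₁ → ℝ) => P.res w.1 w.2.1 :=
  ((Continuous.matrix_mulVec continuous_const continuous_fst).add
    (Continuous.matrix_mulVec continuous_const continuous_snd.fst)).sub continuous_const

/-- The stacked gradient of the augmented Lagrangian as a function of `(x, y, λ)`. -/
noncomputable def stackGrad (p : Params) (w : (Fin n₁ → ℝ) × (Fin n₂ → ℝ) × (Fin m₁ → ℝ)) :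
    Fin n₁ ⊕ Fin n₂ → ℝ :=
  Sum.elim (gradX P p w.1 w.2.1 w.2.2) (gradY P p w.1 w.2.1 w.2.2)

theorem continuous_stackGrad (p : Params) : Continuous (P.stackGrad p) := by
  have h : Continuous fun w : (Fin n₁ → ℝ) × (Fin n₂ → ℝ) × (Fin m₁ → ℝ) =>
      w.2.2 - p.β • P.res w.1 w.2.1 :=
    continuous_snd.snd.sub (P.continuous_res.const_smul p.β)
  have h1 : Continuous fun w : (Fin n₁ → ℝ) × (Fin n₂ → ℝ) × (Fin m₁ → ℝ) =>
      gradX P p w.1 w.2.1 w.2.2 :=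
    ((continuous_grad P.f_smooth).comp continuous_fst).sub
      (Continuous.matrix_mulVec continuous_const h)
  have h2 : Continuous fun w : (Fin n₁ → ℝ) × (Fin n₂ → ℝ) × (Fin m₁ → ℝ) =>
      gradY P p w.1 w.2.1 w.2.2 :=
    ((continuous_grad P.θ_smooth).comp continuous_snd.fst).sub
      (Continuous.matrix_mulVec continuous_const h)
  refine continuous_pi fun i => ?_
  rcases i with i | i
  · exact (continuous_apply i).comp h1
  · exact (continuous_apply i).comp h2

theorem continuous_augLag (β : ℝ) : Continuous
    fun w : (Fin n₁ → ℝ) × (Fin n₂ → ℝ) × (Fin m₁ → ℝ) => P.augLag β w.1 w.2.1 w.2.2 := by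
  simp only [augLag, enorm2_sq]
  have h := P.continuous_res
  exact (((P.f_smooth.continuous.comp continuous_fst).add
    (P.θ_smooth.continuous.comp continuous_snd.fst)).sub
    (continuous_snd.snd.dotProduct h)).add
    (continuous_const.mul (h.dotProduct h))

theorem augLag_add_smul_res (β ξ : ℝ) (x : Fin n₁ → ℝ) (y : Fin n₂ → ℝ) (lam : Fin m₁ → ℝ) :
    P.augLag β x y (lam + ξ • P.res x y) =
      P.augLag β x y lam - ξ * enorm2 (P.res x y) ^ 2 := by
  simp only [augLag, enorm2_sq, add_dotProduct, smul_dotProduct, smul_eq_mul]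
  ring

end Problem

namespace Trace

variable {n₁ n₂ m₁ m₂ l₁ l₂ : ℕ}

/-- The assumptions of the convergence analysis. -/
structure Setting (P : Problem n₁ n₂ m₁ m₂ l₁ l₂) (p : Params) (T : Trace n₁ n₂ m₁ m₂ l₁ l₂)
    (x : Fin n₁ → ℝ) (y : Fin n₂ → ℝ) (lam : Fin m₁ → ℝ) : Prop where
  c_eq : p.c = 1
  run : T.IsRun P p
  hessians : T.UniformHessians P p
  second : T.SecondOrder P x y lam
  ortho : P.Aᵀ * P.B = 0

namespace Setting

variable {P : Problem n₁ n₂ m₁ m₂ l₁ l₂} {p : Params} {T : Trace n₁ n₂ m₁ m₂ l₁ l₂}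
  {x : Fin n₁ → ℝ} {y : Fin n₂ → ℝ} {lam : Fin m₁ → ℝ} (h : Setting P p T x y lam)

include h

theorem u_mem (k : ℕ) : T.u k ∈ P.feasStack := h.run.u_mem h.c_eq h.ortho k

theorem isStep (k : ℕ) : T.IsStep P p k := h.run.isStep h.c_eq h.ortho k

theorem exists_w_bound : ∃ R, ∀ k, ‖T.w k‖ ≤ R := by
  obtain ⟨R, hR⟩ := isBounded_iff_forall_norm_le.1 h.second.bounded
  exact ⟨R, fun k => hR _ ⟨k, rfl⟩⟩

theorem exists_bound_of_continuous {G : Type} [SeminormedAddCommGroup G]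
    {a : (Fin n₁ → ℝ) × (Fin n₂ → ℝ) × (Fin m₁ → ℝ) → G} (ha : Continuous a) :
    ∃ C, ∀ k, ‖a (T.w k)‖ ≤ C := by
  obtain ⟨R, hR⟩ := h.exists_w_bound
  obtain ⟨C, hC⟩ := (isCompact_closedBall (0 : (Fin n₁ → ℝ) × (Fin n₂ → ℝ) × (Fin m₁ → ℝ))
    R).exists_bound_of_continuousOn ha.continuousOn
  exact ⟨C, fun k => hC _ (by simpa using hR k)⟩

theorem exists_Hu_bound : ∃ R, 0 ≤ R ∧ ∀ k i j, |T.Hu P p k i j| ≤ R := by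
  obtain ⟨R, hR⟩ := h.hessians.2 Set.univ (by rw [Set.image_univ]; exact h.second.bounded)
  exact ⟨max R 0, le_max_right _ _, fun k i j => ((hR k trivial i j).1).trans (le_max_left _ _)⟩

theorem exists_qnorm_lower : ∃ η, 0 < η ∧
    ∀ k, η * ‖T.du P p k‖ ^ 2 ≤ qnorm (T.Hu P p k) (T.du P p k) := by
  obtain ⟨η, h0, hη⟩ := h.hessians.1
  exact ⟨η, h0, fun k => qnorm_lower h0.le (hη k).1 _⟩

theorem g_dotProduct_du (k : ℕ) :
    T.g P p k ⬝ᵥ T.du P p k = -qnorm (T.Hu P p k) (T.du P p k) - multTerm P p T k :=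
  h.run.g_dotProduct_du h.c_eq h.ortho k

theorem multTerm_nonneg (k : ℕ) : 0 ≤ multTerm P p T k :=
  h.run.multTerm_nonneg h.c_eq h.ortho k

theorem exists_du_bound : ∃ R, ∀ k, ‖T.du P p k‖ ≤ R := by
  obtain ⟨η, h0, hη⟩ := h.exists_qnorm_lower
  obtain ⟨C, hC⟩ := h.exists_bound_of_continuous (P.continuous_stackGrad p)
  refine ⟨Fintype.card (Fin n₁ ⊕ Fin n₂) * C / η, fun k => ?_⟩
  have h1 := h.g_dotProduct_du k
  have h2 := h.multTerm_nonneg k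
  have h3 := (abs_le.1 (abs_dotProduct_le (T.g P p k) (T.du P p k))).1
  have h4 : ‖T.g P p k‖ ≤ C := hC k
  have h5 : (Fintype.card (Fin n₁ ⊕ Fin n₂) : ℝ) * ‖T.g P p k‖ * ‖T.du P p k‖ ≤
      Fintype.card (Fin n₁ ⊕ Fin n₂) * C * ‖T.du P p k‖ := by gcongr
  have h6 := hη k
  rw [le_div_iff₀ h0]
  rcases (norm_nonneg (T.du P p k)).eq_or_lt with h7 | h7
  · rw [← h7, zero_mul]
    have := (norm_nonneg _).trans h4
    positivity
  · refine le_of_mul_le_mul_right ?_ h7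
    nlinarith

theorem exists_compact : ∃ K : Set (Fin n₁ ⊕ Fin n₂ → ℝ), IsCompact K ∧ Convex ℝ K ∧
    K ⊆ P.feasStack ∧ ∀ k, T.u k ∈ K ∧ T.u k + T.du P p k ∈ K := by
  obtain ⟨R₁, hR₁⟩ := h.exists_w_bound
  obtain ⟨R₂, hR₂⟩ := h.exists_du_bound
  have hu : ∀ k, ‖T.u k‖ ≤ R₁ := fun k => by
    have h1 : ‖T.x k‖ ≤ R₁ := (norm_fst_le (T.w k)).trans (hR₁ k)
    have h2 : ‖T.y k‖ ≤ R₁ :=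
      (norm_fst_le (T.w k).2).trans ((norm_snd_le (T.w k)).trans (hR₁ k))
    refine (pi_norm_le_iff_of_nonneg ((norm_nonneg _).trans h1)).2 fun i => ?_
    rcases i with i | i
    · exact (norm_le_pi_norm (T.x k) i).trans h1
    · exact (norm_le_pi_norm (T.y k) i).trans h2
  refine ⟨P.feasStack ∩ Metric.closedBall 0 (R₁ + R₂),
    (isCompact_closedBall _ _).inter_left P.isClosed_feasStack,
    P.convex_feasStack.inter (convex_closedBall _ _), Set.inter_subset_left, fun k =>
    ⟨⟨h.u_mem k, ?_⟩, h.run.u_add_du_mem h.c_eq h.ortho k, ?_⟩⟩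
  · have := (norm_nonneg _).trans (hR₂ k)
    simpa using (hu k).trans (by linarith)
  · simpa using (norm_add_le _ _).trans (add_le_add (hu k) (hR₂ k))

theorem contDiffAt_obj {u : Fin n₁ ⊕ Fin n₂ → ℝ} (hu : u ∈ P.feasStack) :
    ContDiffAt ℝ 2 P.obj u := by
  obtain ⟨U, hU, hsub, hf, hθ⟩ := h.second.smooth
  exact (P.exists_open_smooth U hU hf hθ).2 u (hsub hu)

theorem differentiableAt_fderiv_obj {u : Fin n₁ ⊕ Fin n₂ → ℝ} (hu : u ∈ P.feasStack) :
    DifferentiableAt ℝ (fderiv ℝ P.obj) u :=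
  ((h.contDiffAt_obj hu).fderiv_right (m := 1) (by norm_num)).differentiableAt one_ne_zero

theorem continuousOn_fderiv_fderiv_obj :
    ContinuousOn (fderiv ℝ (fderiv ℝ P.obj)) P.feasStack := fun _ hu =>
  (((h.contDiffAt_obj hu).fderiv_right (m := 1) (by norm_num)).fderiv_right
    (m := 0) (by norm_num)).continuousAt.continuousWithinAt

theorem fderiv_fderiv_stackLag {u : Fin n₁ ⊕ Fin n₂ → ℝ} (hu : u ∈ P.feasStack)
    (lam' : Fin m₁ → ℝ) : fderiv ℝ (fderiv ℝ (P.stackLag p.β lam')) u =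
      fderiv ℝ (fderiv ℝ P.obj) u + P.penaltyHess p.β :=
  (P.hasFDerivAt_fderiv_stackLag p.β lam' (h.differentiableAt_fderiv_obj hu)).fderiv

theorem abs_taylor_stackLag_le {u d : Fin n₁ ⊕ Fin n₂ → ℝ}
    (hu : ∀ s ∈ Set.Icc (0 : ℝ) 1, u + s • d ∈ P.feasStack) (lam' : Fin m₁ → ℝ)
    {L : (Fin n₁ ⊕ Fin n₂ → ℝ) →L[ℝ] (Fin n₁ ⊕ Fin n₂ → ℝ) →L[ℝ] ℝ} {C : ℝ}
    (hC : ∀ s ∈ Set.Icc (0 : ℝ) 1,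
      ‖fderiv ℝ (fderiv ℝ (P.stackLag p.β lam')) (u + s • d) - L‖ ≤ C) :
    |P.stackLag p.β lam' (u + d) - P.stackLag p.β lam' u - fderiv ℝ (P.stackLag p.β lam') u d
      - 1 / 2 * L d d| ≤ C * ‖d‖ ^ 2 :=
  abs_taylor_le (fun _ _ => P.differentiable_stackLag _ _ _)
    (fun s hs => (P.hasFDerivAt_fderiv_stackLag p.β lam'
      (h.differentiableAt_fderiv_obj (hu s hs))).differentiableAt) hC

theorem exists_quadratic_bound : ∃ C, 0 < C ∧ ∀ k, ∀ t ∈ Set.Icc (0 : ℝ) 1,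
    |P.stackLag p.β (T.lam k) (T.u k + t • T.du P p k) - P.stackLag p.β (T.lam k) (T.u k)
      - t * (T.g P p k ⬝ᵥ T.du P p k)| ≤ C * t ^ 2 * ‖T.du P p k‖ ^ 2 := by
  obtain ⟨K, hK, hconv, hsub, hmem⟩ := h.exists_compact
  obtain ⟨C, hC⟩ := exists_norm_add_le hK (h.continuousOn_fderiv_fderiv_obj.mono hsub)
    (P.penaltyHess p.β)
  refine ⟨max C 1, by positivity, fun k t ht => ?_⟩
  have hseg : ∀ s ∈ Set.Icc (0 : ℝ) 1, T.u k + s • t • T.du P p k ∈ K := fun s hs => by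
    rw [smul_smul]
    exact hconv.add_smul_mem (hmem k).1 (hmem k).2
      ⟨mul_nonneg hs.1 ht.1, mul_le_one₀ hs.2 ht.1 ht.2⟩
  have := h.abs_taylor_stackLag_le (fun s hs => hsub (hseg s hs)) (T.lam k) (L := 0) (C := max C 1)
    (fun s hs => by
      rw [h.fderiv_fderiv_stackLag (hsub (hseg s hs))]
      exact (hC _ (hseg s hs)).trans (le_max_left _ _))
  rw [map_smul, u, P.fderiv_stackLag_apply p] at this
  simp only [zero_apply, mul_zero, sub_zero, smul_eq_mul, norm_smul, Real.norm_eq_abs,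
    mul_pow, sq_abs] at this
  rw [mul_assoc]
  exact this

theorem exists_t_lower : ∃ τ, 0 < τ ∧ ∀ k, τ ≤ T.t k := by
  obtain ⟨η, hη0, hη⟩ := h.exists_qnorm_lower
  obtain ⟨C, hC0, hC⟩ := h.exists_quadratic_bound
  have hρ := p.ρ_mem
  have hσ := p.σ_mem
  refine ⟨min 1 (p.σ * ((1 - p.ρ) * η / C)), ?_, fun k => ?_⟩
  · have : 0 < (1 - p.ρ) * η / C := div_pos (mul_pos (by linarith [hρ.2]) hη0) hC0
    exact lt_min one_pos (mul_pos hσ.1 this)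
  obtain ⟨i, hi⟩ := h.run.t_eq_pow h.c_eq k
  rcases i with _ | i
  · rw [hi, pow_zero]
    exact min_le_left _ _
  refine (min_le_right _ _).trans ?_
  rw [hi, pow_succ']
  refine mul_le_mul_of_nonneg_left ?_ hσ.1.le
  set s := p.σ ^ i with hs
  have hs0 : 0 < s := pow_pos hσ.1 i
  have hs1 : s ≤ 1 := pow_le_one₀ hσ.1.le hσ.2.le
  have hnot : ¬ T.Armijo P p k s := fun hA => by
    have h1 := h.run.pow_le_t h.c_eq hA
    rw [hi, pow_succ', ← hs] at h1
    nlinarith [hσ.2]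
  rw [armijo_iff h.ortho, not_le] at hnot
  have h1 := (abs_le.1 (hC k s ⟨hs0.le, hs1⟩)).2
  have h2 := h.g_dotProduct_du k
  have h3 := h.multTerm_nonneg k
  have h4 := hη k
  set q := qnorm (T.Hu P p k) (T.du P p k)
  have h5 : s * ((1 - p.ρ) * q) < s * (C * s * ‖T.du P p k‖ ^ 2) := by
    rw [h2] at h1
    nlinarith [mul_nonneg hs0.le h3]
  have h6 : (1 - p.ρ) * q < C * s * ‖T.du P p k‖ ^ 2 := lt_of_mul_lt_mul_left h5 hs0.le
  have h7 : (1 - p.ρ) * (η * ‖T.du P p k‖ ^ 2) ≤ (1 - p.ρ) * q :=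
    mul_le_mul_of_nonneg_left h4 (by linarith [hρ.2])
  have h8 : ((1 - p.ρ) * η) * ‖T.du P p k‖ ^ 2 < (s * C) * ‖T.du P p k‖ ^ 2 := by linarith
  rw [div_le_iff₀ hC0]
  exact (lt_of_mul_lt_mul_right h8 (sq_nonneg _)).le

theorem lag_succ_le (k : ℕ) : P.augLag p.β (T.x (k + 1)) (T.y (k + 1)) (T.lam (k + 1)) ≤
    P.augLag p.β (T.x k) (T.y k) (T.lam k)
      - p.ρ * T.t k * qnorm (T.Hu P p k) (T.du P p k)
      - p.ξ * enorm2 (P.res (T.x (k + 1)) (T.y (k + 1))) ^ 2 := by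
  rw [h.run.next_lam, P.augLag_add_smul_res]
  have h1 := (armijo_iff h.ortho k _).1 (h.run.line_search k).1.2
  rw [← h.run.u_succ] at h1
  have h2 : P.stackLag p.β (T.lam k) (T.u (k + 1)) =
    P.augLag p.β (T.x (k + 1)) (T.y (k + 1)) (T.lam k) := rfl
  have h3 : P.stackLag p.β (T.lam k) (T.u k) =
    P.augLag p.β (T.x k) (T.y k) (T.lam k) := rfl
  rw [h2, h3] at h1
  linarith

theorem tendsto_du_res : Tendsto (fun k => ‖T.du P p k‖) atTop (𝓝 0) ∧
    Tendsto (fun k => enorm2 (P.res (T.x k) (T.y k))) atTop (𝓝 0) := by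
  obtain ⟨η, hη0, hη⟩ := h.exists_qnorm_lower
  obtain ⟨τ, hτ0, hτ⟩ := h.exists_t_lower
  obtain ⟨C, hC⟩ := h.exists_bound_of_continuous (P.continuous_augLag p.β)
  have hρ := p.ρ_mem.1
  have hξ := p.ξ_pos
  set L : ℕ → ℝ := fun k => P.augLag p.β (T.x k) (T.y k) (T.lam k) with hL
  have hstep : ∀ k, p.ρ * τ * η * ‖T.du P p k‖ ^ 2 +
      p.ξ * enorm2 (P.res (T.x (k + 1)) (T.y (k + 1))) ^ 2 ≤ L k - L (k + 1) := fun k => by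
    have h1 := h.lag_succ_le k
    have h2 : p.ρ * τ * (η * ‖T.du P p k‖ ^ 2) ≤
        p.ρ * T.t k * qnorm (T.Hu P p k) (T.du P p k) := by
      have := hτ k
      have := hη k
      gcongr
      exact mul_nonneg hρ.le (hτ0.le.trans (hτ k))
    simp only [hL]
    linarith
  have hanti : Antitone L := antitone_nat_of_succ_le fun k => by
    have : 0 ≤ p.ρ * τ * η * ‖T.du P p k‖ ^ 2 +
      p.ξ * enorm2 (P.res (T.x (k + 1)) (T.y (k + 1))) ^ 2 := by positivity
    linarith [hstep k]
  have hlim := tendsto_sub_succ_of_antitone hanti (b := -C) fun k => (abs_le.1 (hC k)).1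
  have key : ∀ {a : ℕ → ℝ} {c : ℝ}, 0 < c → (∀ k, 0 ≤ a k) →
      (∀ k, c * a k ^ 2 ≤ L k - L (k + 1)) → Tendsto a atTop (𝓝 0) := by
    intro a c hc ha hle
    have h1 : Tendsto (fun k => c * a k ^ 2) atTop (𝓝 0) :=
      squeeze_zero (fun k => mul_nonneg hc.le (sq_nonneg _)) hle hlim
    have h2 : Tendsto (fun k => Real.sqrt (c⁻¹ * (c * a k ^ 2))) atTop (𝓝 0) := by
      simpa using (h1.const_mul c⁻¹).sqrt
    refine h2.congr fun k => ?_
    rw [inv_mul_cancel_left₀ hc.ne', Real.sqrt_sq (ha k)]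
  constructor
  · refine key (c := p.ρ * τ * η) (by positivity) (fun k => norm_nonneg _) fun k => ?_
    exact le_trans (le_add_of_nonneg_right (by positivity)) (hstep k)
  · refine (tendsto_add_atTop_iff_nat (f := fun k => enorm2 (P.res (T.x k) (T.y k))) 1).1 ?_
    refine key hξ (fun k => enorm2_nonneg _) fun k => ?_
    exact le_trans (le_add_of_nonneg_left (by positivity)) (hstep k)

theorem eventually_abs_taylor_le {ε : ℝ} (hε : 0 < ε) : ∀ᶠ k in atTop,
    |P.stackLag p.β (T.lam k) (T.u k + T.du P p k) - P.stackLag p.β (T.lam k) (T.u k)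
      - T.g P p k ⬝ᵥ T.du P p k - 1 / 2 * (T.du P p k ⬝ᵥ
        (P.hessAugLag p.β (T.x k) (T.y k) (T.lam k) *ᵥ T.du P p k))| ≤ ε * ‖T.du P p k‖ ^ 2 := by
  obtain ⟨K, hK, hconv, hsub, hmem⟩ := h.exists_compact
  obtain ⟨δ, hδ, hδε⟩ := exists_norm_add_sub_add_le hK
    (h.continuousOn_fderiv_fderiv_obj.mono hsub) (P.penaltyHess p.β) hε
  filter_upwards [h.tendsto_du_res.1.eventually_lt_const hδ] with k hk
  have hseg : ∀ s ∈ Set.Icc (0 : ℝ) 1, T.u k + s • T.du P p k ∈ K := fun s hs =>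
    hconv.add_smul_mem (hmem k).1 (hmem k).2 hs
  have := h.abs_taylor_stackLag_le (fun s hs => hsub (hseg s hs)) (T.lam k)
    (L := fderiv ℝ (fderiv ℝ (P.stackLag p.β (T.lam k))) (T.u k)) (C := ε) (fun s hs => by
      rw [h.fderiv_fderiv_stackLag (hsub (hseg s hs)), h.fderiv_fderiv_stackLag (h.u_mem k)]
      refine hδε _ (hseg s hs) _ (hmem k).1 ?_
      rw [add_sub_cancel_left, norm_smul, Real.norm_of_nonneg hs.1]
      exact (mul_le_of_le_one_left (norm_nonneg _) hs.2).trans_lt hk)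
  rw [fderiv_fderiv_apply_eq_hess, u, P.fderiv_stackLag_apply p] at this
  exact this

theorem eventually_t_eq_one (hρ : p.ρ < 1 / 2)
    (herr : ∀ ε > 0, ∀ᶠ k in atTop, |T.du P p k ⬝ᵥ T.hessErr P p k| ≤
      ε * ‖T.du P p k‖ ^ 2 + multTerm P p T k) : ∀ᶠ k in atTop, T.t k = 1 := by
  obtain ⟨η, hη0, hη⟩ := h.exists_qnorm_lower
  have hε : 0 < (1 / 2 - p.ρ) * η / 2 := by
    have : 0 < 1 / 2 - p.ρ := by linarith
    positivity
  filter_upwards [herr _ hε, h.eventually_abs_taylor_le hε] with k h1 h2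
  refine le_antisymm (h.run.t_le_one h.c_eq k) ?_
  rw [← pow_zero p.σ]
  refine h.run.pow_le_t h.c_eq ((armijo_iff h.ortho k _).2 ?_)
  rw [pow_zero, one_smul, mul_one]
  have h3 := (abs_le.1 h2).2
  rw [h.g_dotProduct_du] at h3
  have h4 : T.du P p k ⬝ᵥ T.hessErr P p k = qnorm (T.Hu P p k) (T.du P p k) -
      T.du P p k ⬝ᵥ (P.hessAugLag p.β (T.x k) (T.y k) (T.lam k) *ᵥ T.du P p k) := by
    rw [hessErr, Matrix.sub_mulVec, dotProduct_sub, qnorm]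
  have h5 := (abs_le.1 h1).1
  have h6 := h.multTerm_nonneg k
  have h7 := hη k
  rw [h4] at h5
  have h8 : (1 / 2 - p.ρ) * (η * ‖T.du P p k‖ ^ 2) ≤
      (1 / 2 - p.ρ) * qnorm (T.Hu P p k) (T.du P p k) :=
    mul_le_mul_of_nonneg_left h7 (by linarith)
  have h9 := sq_nonneg ‖T.du P p k‖
  nlinarith [mul_nonneg hε.le h9]

end Setting

end Trace

theorem exists_pos_mul_sq_le {W : Type} [NormedAddCommGroup W] [NormedSpace ℝ W]
    [FiniteDimensional ℝ W] (Z : Submodule ℝ W) {q : W → ℝ} (hq : Continuous q)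
    (hq2 : ∀ (c : ℝ) z, q (c • z) = c ^ 2 * q z) (hpos : ∀ z ∈ Z, z ≠ 0 → 0 < q z) :
    ∃ c, 0 < c ∧ ∀ z ∈ Z, c * ‖z‖ ^ 2 ≤ q z := by
  have hK : IsCompact (Metric.sphere (0 : W) 1 ∩ (Z : Set W)) :=
    have := FiniteDimensional.proper_real W
    (isCompact_sphere 0 1).inter_right Z.closed_of_finiteDimensional
  have hmain : ∃ c, 0 < c ∧ ∀ z ∈ Metric.sphere (0 : W) 1 ∩ (Z : Set W), c ≤ q z := by
    rcases (Metric.sphere (0 : W) 1 ∩ (Z : Set W)).eq_empty_or_nonempty with he | he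
    · exact ⟨1, one_pos, by simp [he]⟩
    · obtain ⟨z, hz, hmin⟩ := hK.exists_isMinOn he hq.continuousOn
      refine ⟨q z, hpos z hz.2 ?_, fun z' hz' => hmin hz'⟩
      rintro rfl
      simpa using hz.1
  obtain ⟨c, hc, h⟩ := hmain
  refine ⟨c, hc, fun z hz => ?_⟩
  rcases eq_or_ne z 0 with rfl | hz0
  · have := hq2 0 0
    simp at this
    simp [this]
  · have hn : ‖z‖ ≠ 0 := norm_ne_zero_iff.2 hz0
    have h1 := h (‖z‖⁻¹ • z) ⟨by simp [norm_smul, hn], Z.smul_mem _ hz⟩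
    have h2 := hq2 ‖z‖ (‖z‖⁻¹ • z)
    rw [smul_inv_smul₀ hn] at h2
    rw [h2, mul_comm]
    gcongr

theorem tendsto_of_isolated_mapClusterPt {W : Type} [PseudoMetricSpace W] [ProperSpace W]
    {w : ℕ → W} {a : W} (ha : MapClusterPt a atTop w)
    (hstep : Tendsto (fun k => dist (w (k + 1)) (w k)) atTop (𝓝 0))
    (hiso : ∀ᶠ b in 𝓝 a, MapClusterPt b atTop w → dist b a = 0) :
    Tendsto w atTop (𝓝 a) := by
  obtain ⟨ε, hε, hball⟩ := Metric.eventually_nhds_iff.1 hiso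
  rw [Metric.tendsto_atTop]
  intro δ' hδ'
  obtain ⟨δ, hδ, hδ1, hδ2⟩ : ∃ δ, 0 < δ ∧ δ ≤ δ' ∧ 2 * δ < ε :=
    ⟨min δ' (ε / 3), by positivity, min_le_left _ _, by
      have := min_le_right δ' (ε / 3)
      linarith⟩
  have hK : IsCompact (Metric.closedBall a (2 * δ) \ Metric.ball a δ) :=
    (isCompact_closedBall a (2 * δ)).diff Metric.isOpen_ball
  have hout : ∀ᶠ k in atTop, w k ∉ Metric.closedBall a (2 * δ) \ Metric.ball a δ := by
    by_contra hcon
    obtain ⟨b, hb, hcl⟩ := hK.exists_mapClusterPt_of_frequently hcon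
    have h1 : dist b a ≤ 2 * δ := hb.1
    have h2 := hball (by linarith) hcl
    exact hb.2 (by rw [Metric.mem_ball, h2]; exact hδ)
  obtain ⟨N, hN⟩ := eventually_atTop.1 (hout.and (hstep.eventually_lt_const hδ))
  obtain ⟨k₀, hk₀, hmem⟩ := frequently_atTop.1
    (mapClusterPt_iff_frequently.1 ha _ (Metric.ball_mem_nhds a hδ)) N
  refine ⟨k₀, fun k hk => lt_of_lt_of_le ?_ hδ1⟩
  induction k, hk using Nat.le_induction with
  | base => exact hmem
  | succ k hk ih =>
    have h1 := (hN k (hk₀.trans hk)).2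
    have h2 := (hN (k + 1) (by omega)).1
    by_contra hcon
    refine h2 ⟨?_, hcon⟩
    rw [Metric.mem_closedBall]
    linarith [dist_triangle (w (k + 1)) (w k) a]

namespace Problem

variable {n₁ n₂ m₁ m₂ l₁ l₂ : ℕ} (P : Problem n₁ n₂ m₁ m₂ l₁ l₂)

/-- The linear combination of the constraint rows with the given coefficients. -/
noncomputable def combo :
    ((Fin m₁ → ℝ) × (Fin m₂ → ℝ) × (Fin l₁ → ℝ) × (Fin l₂ → ℝ)) →ₗ[ℝ]
      (Fin n₁ ⊕ Fin n₂ → ℝ) where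
  toFun c := Sum.elim (P.Aᵀ *ᵥ c.1 + P.Eᵀ *ᵥ c.2.1 + P.Cᵀ *ᵥ c.2.2.1)
    (P.Bᵀ *ᵥ c.1 + P.Fᵀ *ᵥ c.2.1 + P.Dᵀ *ᵥ c.2.2.2)
  map_add' c c' := by
    ext (i | i) <;> simp [Matrix.mulVec_add] <;> ring
  map_smul' a c := by
    ext (i | i) <;> simp [Matrix.mulVec_smul] <;> ring

theorem combo_apply (a : Fin m₁ → ℝ) (μ : Fin m₂ → ℝ) (νx : Fin l₁ → ℝ) (νy : Fin l₂ → ℝ) :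
    P.combo (a, μ, νx, νy) = Sum.elim (P.Aᵀ *ᵥ a + P.Eᵀ *ᵥ μ + P.Cᵀ *ᵥ νx)
      (P.Bᵀ *ᵥ a + P.Fᵀ *ᵥ μ + P.Dᵀ *ᵥ νy) := rfl

/-- Coefficients supported on the given index sets. -/
def suppIn (S : Finset (Fin m₂)) (I : Finset (Fin l₁)) (J : Finset (Fin l₂)) :
    Submodule ℝ ((Fin m₁ → ℝ) × (Fin m₂ → ℝ) × (Fin l₁ → ℝ) × (Fin l₂ → ℝ)) where
  carrier := {c | (∀ i ∉ S, c.2.1 i = 0) ∧ (∀ i ∉ I, c.2.2.1 i = 0) ∧ ∀ j ∉ J, c.2.2.2 j = 0}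
  add_mem' := fun h h' => ⟨fun i hi => by simp [h.1 i hi, h'.1 i hi],
    fun i hi => by simp [h.2.1 i hi, h'.2.1 i hi], fun i hi => by simp [h.2.2 i hi, h'.2.2 i hi]⟩
  zero_mem' := by simp
  smul_mem' := fun a c h => ⟨fun i hi => by simp [h.1 i hi],
    fun i hi => by simp [h.2.1 i hi], fun i hi => by simp [h.2.2 i hi]⟩

theorem vecMul_submatrix_eq {κ n : Type} [Fintype κ] (S : Finset κ) (a : κ → ℝ)
    (E : Matrix κ n ℝ) (ha : ∀ i ∉ S, a i = 0) :
    (fun i : S => a i) ᵥ* E.submatrix Subtype.val id = Eᵀ *ᵥ a := by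
  ext j
  rw [Matrix.mulVec_transpose]
  simp only [Matrix.vecMul, dotProduct, Matrix.submatrix_apply, id]
  rw [Finset.sum_coe_sort S (fun i => a i * E i j)]
  exact Finset.sum_subset (Finset.subset_univ S) fun i _ hi => by rw [ha i hi, zero_mul]

theorem vecMul_rowsAll {S : Finset (Fin m₂)} {I : Finset (Fin l₁)} {J : Finset (Fin l₂)}
    {c : (Fin m₁ → ℝ) × (Fin m₂ → ℝ) × (Fin l₁ → ℝ) × (Fin l₂ → ℝ)} (hc : c ∈ suppIn S I J) :
    Sum.elim c.1 (Sum.elim (fun i : S => c.2.1 i)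
      (Sum.elim (fun i : I => c.2.2.1 i) fun j : J => c.2.2.2 j)) ᵥ* P.rowsAll S I J =
      P.combo c := by
  have h1 := vecMul_submatrix_eq S c.2.1 P.E hc.1
  have h2 := vecMul_submatrix_eq S c.2.1 P.F hc.1
  have h3 := vecMul_submatrix_eq I c.2.2.1 P.C hc.2.1
  have h4 := vecMul_submatrix_eq J c.2.2.2 P.D hc.2.2
  simp only [rowsAll, rowsIneq, Matrix.sumElim_vecMul_fromRows, Matrix.vecMul_fromCols,
    Matrix.vecMul_fromBlocks, Sum.elim_comp_inl, Sum.elim_comp_inr, Matrix.vecMul_zero,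
    h1, h2, h3, h4, add_zero, zero_add]
  rw [show c = (c.1, c.2.1, c.2.2.1, c.2.2.2) from rfl, combo_apply]
  ext (i | i) <;> simp [Matrix.mulVec_transpose] <;> ring

theorem LICQ.exists_inverse {P : Problem n₁ n₂ m₁ m₂ l₁ l₂} {x : Fin n₁ → ℝ} {y : Fin n₂ → ℝ}
    (h : P.LICQ x y) : ∃ N : (Fin n₁ ⊕ Fin n₂ → ℝ) →ₗ[ℝ]
      ((Fin m₁ → ℝ) × (Fin m₂ → ℝ) × (Fin l₁ → ℝ) × (Fin l₂ → ℝ)),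
      ∀ c ∈ suppIn (m₁ := m₁) (P.actIneq x y) (P.actX x) (P.actY y), N (P.combo c) = c := by
  have hinj := Matrix.vecMul_injective_iff.2 h
  obtain ⟨N, hN⟩ := LinearMap.exists_leftInverse_of_injective
    (P.combo.domRestrict (suppIn (P.actIneq x y) (P.actX x) (P.actY y))) (by
      rw [LinearMap.ker_eq_bot']
      rintro ⟨c, hc⟩ h0
      rw [LinearMap.domRestrict_apply] at h0
      have h1 := hinj ((P.vecMul_rowsAll hc).trans (h0.trans (Matrix.zero_vecMul _).symm))
      have ha : ∀ i, c.1 i = 0 := fun i => congrFun h1 (Sum.inl i)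
      have hμ : ∀ i, c.2.1 i = 0 := fun i => by
        by_cases hi : i ∈ P.actIneq x y
        · exact congrFun h1 (Sum.inr (Sum.inl ⟨i, hi⟩))
        · exact hc.1 i hi
      have hx : ∀ i, c.2.2.1 i = 0 := fun i => by
        by_cases hi : i ∈ P.actX x
        · exact congrFun h1 (Sum.inr (Sum.inr (Sum.inl ⟨i, hi⟩)))
        · exact hc.2.1 i hi
      have hy : ∀ i, c.2.2.2 i = 0 := fun i => by
        by_cases hi : i ∈ P.actY y
        · exact congrFun h1 (Sum.inr (Sum.inr (Sum.inr ⟨i, hi⟩)))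
        · exact hc.2.2 i hi
      ext1
      exact Prod.ext (funext ha) (Prod.ext (funext hμ) (Prod.ext (funext hx) (funext hy))))
  refine ⟨(Submodule.subtype _).comp N, fun c hc => ?_⟩
  have := LinearMap.congr_fun hN ⟨c, hc⟩
  exact congrArg Subtype.val this

theorem eventually_eq_bound {κ n : Type} [Fintype n] [Finite κ] (C : Matrix κ n ℝ) (lo : κ → EReal)
    (x : n → ℝ) : ∀ᶠ z in 𝓝 x, ∀ i, ((C *ᵥ z) i : EReal) = lo i → ((C *ᵥ x) i : EReal) = lo i := by
  refine eventually_all.2 fun i => ?_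
  by_cases hi : ((C *ᵥ x) i : EReal) = lo i
  · exact Eventually.of_forall fun _ _ => hi
  · have hc : Continuous fun z : n → ℝ => ((C *ᵥ z) i : EReal) :=
      continuous_coe_real_ereal.comp ((continuous_apply i).comp
        (Continuous.matrix_mulVec continuous_const continuous_id))
    filter_upwards [hc.continuousAt.eventually_ne hi] with z hz h
    exact absurd h hz

theorem eventually_actL_subset (x : Fin n₁ → ℝ) : ∀ᶠ z in 𝓝 x, P.actL z ⊆ P.actL x := by
  filter_upwards [eventually_eq_bound P.C P.l x] with z hz i
  simpa [actL] using hz i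

theorem eventually_actV_subset (x : Fin n₁ → ℝ) : ∀ᶠ z in 𝓝 x, P.actV z ⊆ P.actV x := by
  filter_upwards [eventually_eq_bound P.C P.v x] with z hz i
  simpa [actV] using hz i

theorem eventually_actS_subset (y : Fin n₂ → ℝ) : ∀ᶠ z in 𝓝 y, P.actS z ⊆ P.actS y := by
  filter_upwards [eventually_eq_bound P.D P.s y] with z hz i
  simpa [actS] using hz i

theorem eventually_actR_subset (y : Fin n₂ → ℝ) : ∀ᶠ z in 𝓝 y, P.actR z ⊆ P.actR y := by
  filter_upwards [eventually_eq_bound P.D P.r y] with z hz i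
  simpa [actR] using hz i

theorem continuous_ineq :
    Continuous fun u : (Fin n₁ → ℝ) × (Fin n₂ → ℝ) => P.ineq u.1 u.2 :=
  ((Continuous.matrix_mulVec continuous_const continuous_fst).add
    (Continuous.matrix_mulVec continuous_const continuous_snd)).sub continuous_const

theorem eventually_actIneq_subset (x : Fin n₁ → ℝ) (y : Fin n₂ → ℝ) :
    ∀ᶠ u in 𝓝 (x, y), P.actIneq u.1 u.2 ⊆ P.actIneq x y := by
  have : ∀ᶠ u in 𝓝 (x, y), ∀ i, P.ineq u.1 u.2 i = 0 → P.ineq x y i = 0 := by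
    refine eventually_all.2 fun i => ?_
    by_cases hi : P.ineq x y i = 0
    · exact Eventually.of_forall fun _ _ => hi
    · filter_upwards [((continuous_apply i).comp P.continuous_ineq).continuousAt.eventually_ne hi]
        with u hu h
      exact absurd h hu
  filter_upwards [this] with u hu i
  simpa [actIneq] using hu i

theorem stackGrad_eq (p : Params) (x : Fin n₁ → ℝ) (y : Fin n₂ → ℝ) (lam : Fin m₁ → ℝ) :
    P.stackGrad p (x, y, lam) =
      Sum.elim (grad P.f x) (grad P.θ y) - P.combo (lam - p.β • P.res x y, 0, 0, 0) := by
  rw [combo_apply]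
  ext (i | i) <;> simp [stackGrad, gradX, gradY]

theorem combo_dotProduct (c : (Fin m₁ → ℝ) × (Fin m₂ → ℝ) × (Fin l₁ → ℝ) × (Fin l₂ → ℝ))
    (z : Fin n₁ ⊕ Fin n₂ → ℝ) : P.combo c ⬝ᵥ z =
      c.1 ⬝ᵥ (P.A *ᵥ (z ∘ Sum.inl) + P.B *ᵥ (z ∘ Sum.inr))
      + c.2.1 ⬝ᵥ (P.E *ᵥ (z ∘ Sum.inl) + P.F *ᵥ (z ∘ Sum.inr))
      + c.2.2.1 ⬝ᵥ (P.C *ᵥ (z ∘ Sum.inl)) + c.2.2.2 ⬝ᵥ (P.D *ᵥ (z ∘ Sum.inr)) := by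
  rw [show c = (c.1, c.2.1, c.2.2.1, c.2.2.2) from rfl, combo_apply]
  conv_lhs => rw [← Sum.elim_comp_inl_inr z, sumElim_dotProduct_sumElim]
  simp only [add_dotProduct, dotProduct_add, Matrix.mulVec_transpose, ← Matrix.dotProduct_mulVec]
  ring

end Problem

namespace Trace

variable {n₁ n₂ m₁ m₂ l₁ l₂ : ℕ}

namespace Setting

variable {P : Problem n₁ n₂ m₁ m₂ l₁ l₂} {p : Params} {T : Trace n₁ n₂ m₁ m₂ l₁ l₂}
  {x : Fin n₁ → ℝ} {y : Fin n₂ → ℝ} {lam : Fin m₁ → ℝ} (h : Setting P p T x y lam)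

include h

theorem tendsto_du : Tendsto (T.du P p) atTop (𝓝 0) :=
  tendsto_zero_iff_norm_tendsto_zero.2 h.tendsto_du_res.1

theorem tendsto_dx : Tendsto (T.dx P p) atTop (𝓝 0) :=
  tendsto_pi_nhds.2 fun i => (tendsto_pi_nhds.1 h.tendsto_du (Sum.inl i))

theorem tendsto_dy : Tendsto (T.dy P p) atTop (𝓝 0) :=
  tendsto_pi_nhds.2 fun i => (tendsto_pi_nhds.1 h.tendsto_du (Sum.inr i))

theorem tendsto_res : Tendsto (fun k => P.res (T.x k) (T.y k)) atTop (𝓝 0) :=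
  squeeze_zero_norm (fun _ => norm_le_enorm2 _) h.tendsto_du_res.2

theorem tendsto_smul_t {a : ℕ → Fin n₁ ⊕ Fin n₂ → ℝ} (ha : Tendsto a atTop (𝓝 0)) :
    Tendsto (fun k => T.t k • a k) atTop (𝓝 0) := by
  refine squeeze_zero_norm (fun k => ?_) (tendsto_zero_iff_norm_tendsto_zero.1 ha)
  rw [norm_smul, Real.norm_of_nonneg (h.run.t_pos h.c_eq k).le]
  exact mul_le_of_le_one_left (norm_nonneg _) (h.run.t_le_one h.c_eq k)

theorem tendsto_dist_w : Tendsto (fun k => dist (T.w (k + 1)) (T.w k)) atTop (𝓝 0) := by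
  have h1 := h.tendsto_smul_t h.tendsto_du
  have hx : Tendsto (fun k => T.x (k + 1) - T.x k) atTop (𝓝 0) := by
    simp only [h.run.next_x, add_sub_cancel_left]
    exact tendsto_pi_nhds.2 fun i => (tendsto_pi_nhds.1 h1 (Sum.inl i))
  have hy : Tendsto (fun k => T.y (k + 1) - T.y k) atTop (𝓝 0) := by
    simp only [h.run.next_y, add_sub_cancel_left]
    exact tendsto_pi_nhds.2 fun i => (tendsto_pi_nhds.1 h1 (Sum.inr i))
  have hl : Tendsto (fun k => T.lam (k + 1) - T.lam k) atTop (𝓝 0) := by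
    simp only [h.run.next_lam, add_sub_cancel_left]
    simpa using (h.tendsto_res.comp (tendsto_add_atTop_nat 1)).const_smul p.ξ
  have := (hx.prodMk_nhds (hy.prodMk_nhds hl)).norm
  rw [show ((0 : Fin n₁ → ℝ), (0 : Fin n₂ → ℝ), (0 : Fin m₁ → ℝ)) = 0 from rfl, norm_zero] at this
  exact this.congr fun k => (dist_eq_norm _ _).symm

theorem tendsto_mu_sub : Tendsto (fun k => (T.sol P p k).μx - (T.sol P p k).μy) atTop (𝓝 0) := by
  refine squeeze_zero_norm (fun k => (h.isStep k).diff) ?_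
  have h1 : Tendsto (fun k => enorm2 (T.du P p k)) atTop (𝓝 0) :=
    squeeze_zero (fun _ => enorm2_nonneg _) (fun _ => enorm2_le _)
      (by simpa using h.tendsto_du_res.1.const_mul (Fintype.card (Fin n₁ ⊕ Fin n₂) : ℝ))
  have h2 := h1.rpow_const (p := p.τ₁) (Or.inr p.τ₁_pos.le)
  have h3 := h.tendsto_du_res.2.rpow_const (p := p.τ₂) (Or.inr p.τ₂_pos.le)
  rw [Real.zero_rpow p.τ₁_pos.ne'] at h2
  rw [Real.zero_rpow p.τ₂_pos.ne'] at h3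
  simpa using (h2.add (h3.const_mul p.M₂)).const_mul p.M₁

theorem tendsto_Hu_du : Tendsto (fun k => T.Hu P p k *ᵥ T.du P p k) atTop (𝓝 0) := by
  obtain ⟨R, hR0, hR⟩ := h.exists_Hu_bound
  refine squeeze_zero_norm (fun k => norm_mulVec_le hR0 (hR k) _) ?_
  simpa using h.tendsto_du_res.1.const_mul (Fintype.card (Fin n₁ ⊕ Fin n₂) * R)

theorem combo_sol (k : ℕ) : P.combo (0, (T.sol P p k).μx, T.nuX P p k, T.nuY P p k) =
    -(P.stackGrad p (T.w k) + T.Hu P p k *ᵥ T.du P p k)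
      + Sum.elim (0 : Fin n₁ → ℝ) (P.Fᵀ *ᵥ ((T.sol P p k).μx - (T.sol P p k).μy)) := by
  have hs := h.isStep k
  rw [Problem.combo_apply]
  ext (i | i)
  · have := congrFun hs.stat_x i
    simp only [Pi.add_apply, Pi.zero_apply] at this
    simp [Problem.stackGrad, w, Hu, calHu, du, Matrix.fromBlocks_mulVec]
    linarith
  · have := congrFun hs.stat_y i
    simp only [Pi.add_apply, Pi.zero_apply] at this
    simp [Problem.stackGrad, w, Hu, calHu, du, Matrix.fromBlocks_mulVec, Matrix.mulVec_sub]
    linarith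

section Limits

variable {F : Filter ℕ} (hF : F ≤ atTop) {x' : Fin n₁ → ℝ} {y' : Fin n₂ → ℝ} {lam' : Fin m₁ → ℝ}
  (hw : Tendsto T.w F (𝓝 (x', y', lam')))

include hF hw

omit h hF in
theorem tendsto_x : Tendsto T.x F (𝓝 x') := (continuous_fst.tendsto _).comp hw

omit h hF in
theorem tendsto_y : Tendsto T.y F (𝓝 y') := (continuous_snd.fst.tendsto _).comp hw

theorem tendsto_xt : Tendsto (T.xt P p) F (𝓝 x') := by
  simpa [dx] using (tendsto_x hw).add (h.tendsto_dx.mono_left hF)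

theorem tendsto_yt : Tendsto (T.yt P p) F (𝓝 y') := by
  simpa [dy] using (tendsto_y hw).add (h.tendsto_dy.mono_left hF)

theorem eventually_act_box : ∀ᶠ k in F,
    (P.actL (T.xt P p k) ⊆ P.actL x' ∧ P.actV (T.xt P p k) ⊆ P.actV x') ∧
    P.actS (T.yt P p k) ⊆ P.actS y' ∧ P.actR (T.yt P p k) ⊆ P.actR y' :=
  ((h.tendsto_xt hF hw).eventually ((P.eventually_actL_subset x').and
    (P.eventually_actV_subset x'))).and ((h.tendsto_yt hF hw).eventually
    ((P.eventually_actS_subset y').and (P.eventually_actR_subset y')))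

theorem eventually_ineq : ∀ᶠ k in F, ∀ i ∉ P.actIneq x' y',
    2 * (|(P.E *ᵥ T.dx P p k) i| + |(P.F *ᵥ T.dy P p k) i|) < |P.ineq (T.x k) (T.y k) i| := by
  refine eventually_all.2 fun i => ?_
  by_cases hi : i ∈ P.actIneq x' y'
  · exact Eventually.of_forall fun k hk => absurd hi hk
  have h0 : P.ineq x' y' i ≠ 0 := by simpa [Problem.actIneq] using hi
  have hE : Tendsto (fun k => (P.E *ᵥ T.dx P p k) i) F (𝓝 0) := by
    have := ((Continuous.matrix_mulVec (continuous_const (y := P.E)) continuous_id).tendsto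
      (0 : Fin n₁ → ℝ)).comp (h.tendsto_dx.mono_left hF)
    simpa using tendsto_pi_nhds.1 this i
  have hF' : Tendsto (fun k => (P.F *ᵥ T.dy P p k) i) F (𝓝 0) := by
    have := ((Continuous.matrix_mulVec (continuous_const (y := P.F)) continuous_id).tendsto
      (0 : Fin n₂ → ℝ)).comp (h.tendsto_dy.mono_left hF)
    simpa using tendsto_pi_nhds.1 this i
  have hi' : Tendsto (fun k => P.ineq (T.x k) (T.y k) i) F (𝓝 (P.ineq x' y' i)) := by
    exact tendsto_pi_nhds.1 ((P.continuous_ineq.tendsto (x', y')).comp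
      ((tendsto_x hw).prodMk_nhds (tendsto_y hw))) i
  have hl := ((hE.abs.add hF'.abs).const_mul 2)
  filter_upwards [hl.eventually_lt hi'.abs (by simpa using h0)] with k hk _
  exact hk

end Limits

end Setting

end Trace

namespace Problem

variable {n₁ n₂ m₁ m₂ l₁ l₂ : ℕ} (P : Problem n₁ n₂ m₁ m₂ l₁ l₂)

/-- A KKT point whose box multipliers are given in signed form. -/
structure IsSignedKKT (p : Params) (x : Fin n₁ → ℝ) (y : Fin n₂ → ℝ) (lam : Fin m₁ → ℝ)
    (c : (Fin m₁ → ℝ) × (Fin m₂ → ℝ) × (Fin l₁ → ℝ) × (Fin l₂ → ℝ)) : Prop where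
  fst : c.1 = 0
  stat : P.stackGrad p (x, y, lam) + P.combo c = 0
  res : P.res x y = 0
  feas : (x, y) ∈ P.feasPlus
  nonneg : ∀ i, 0 ≤ c.2.1 i
  suppIneq : ∀ i ∉ P.actIneq x y, c.2.1 i = 0
  suppL : ∀ i ∉ P.actL x, 0 ≤ c.2.2.1 i
  suppV : ∀ i ∉ P.actV x, c.2.2.1 i ≤ 0
  suppS : ∀ j ∉ P.actS y, 0 ≤ c.2.2.2 j
  suppR : ∀ j ∉ P.actR y, c.2.2.2 j ≤ 0

/-- The multipliers corresponding to signed ones. -/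
def signedMult (c : (Fin m₁ → ℝ) × (Fin m₂ → ℝ) × (Fin l₁ → ℝ) × (Fin l₂ → ℝ)) :
    Mult m₂ l₁ l₂ :=
  ⟨c.2.1, fun i => max (-c.2.2.1 i) 0, fun i => max (c.2.2.1 i) 0,
    fun j => max (-c.2.2.2 j) 0, fun j => max (c.2.2.2 j) 0⟩

theorem boxCompl_of_signed {ι : Type} {lo hi : ι → EReal} {z ν : ι → ℝ}
    (hfeas : ∀ i, lo i ≤ (z i : EReal) ∧ (z i : EReal) ≤ hi i)
    (hlo : ∀ i, (z i : EReal) ≠ lo i → 0 ≤ ν i) (hhi : ∀ i, (z i : EReal) ≠ hi i → ν i ≤ 0) :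
    BoxCompl lo hi z (fun i => max (-ν i) 0) fun i => max (ν i) 0 := by
  refine fun i => ⟨⟨le_max_right _ _, (hfeas i).1, ?_⟩, le_max_right _ _, (hfeas i).2, ?_⟩
  · by_cases h : (z i : EReal) = lo i
    · rw [← h, ← EReal.coe_sub, sub_self, EReal.coe_zero, mul_zero]
    · have h0 : max (-ν i) 0 = 0 := max_eq_right (neg_nonpos.2 (hlo i h))
      simp only [h0, EReal.coe_zero, zero_mul]
  · by_cases h : (z i : EReal) = hi i
    · rw [← h, ← EReal.coe_sub, sub_self, EReal.coe_zero, mul_zero]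
    · have h0 : max (ν i) 0 = 0 := max_eq_right (hhi i h)
      simp only [h0, EReal.coe_zero, zero_mul]

theorem posPart_sub_negPart_fun {ι : Type} (ν : ι → ℝ) :
    ((fun i => max (ν i) 0) - fun i => max (-ν i) 0) = ν := by
  ext i
  rcases le_total (ν i) 0 with h | h
  · simp [max_eq_right h, max_eq_left (neg_nonneg.2 h)]
  · simp [h]

namespace IsSignedKKT

variable {P} {p : Params} {x : Fin n₁ → ℝ} {y : Fin n₂ → ℝ} {lam : Fin m₁ → ℝ}
  {c : (Fin m₁ → ℝ) × (Fin m₂ → ℝ) × (Fin l₁ → ℝ) × (Fin l₂ → ℝ)}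

theorem isKKT (h : P.IsSignedKKT p x y lam c) : P.IsKKT x y lam (signedMult c) := by
  have hstat := h.stat
  rw [stackGrad_eq, h.res, show c = (c.1, c.2.1, c.2.2.1, c.2.2.2) from rfl, combo_apply,
    combo_apply, h.fst] at hstat
  constructor
  · simp only [signedMult, posPart_sub_negPart_fun]
    ext i
    simpa [add_assoc] using congrFun hstat (Sum.inl i)
  · simp only [signedMult, posPart_sub_negPart_fun]
    ext i
    simpa [add_assoc] using congrFun hstat (Sum.inr i)
  · exact h.res
  · refine fun i => ⟨h.nonneg i, ?_, ?_⟩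
    · simpa using h.feas.2.2 i
    · by_cases hi : i ∈ P.actIneq x y
      · have : P.ineq x y i = 0 := by simpa [actIneq] using hi
        simp [this]
      · have : (signedMult c).μ i = 0 := h.suppIneq i hi
        rw [this, zero_mul]
  · exact boxCompl_of_signed h.feas.1 (fun i hi => h.suppL i (by simpa [actL] using hi))
      fun i hi => h.suppV i (by simpa [actV] using hi)
  · exact boxCompl_of_signed h.feas.2.1 (fun i hi => h.suppS i (by simpa [actS] using hi))
      fun i hi => h.suppR i (by simpa [actR] using hi)

theorem eq_zero_of_not_mem_actX (h : P.IsSignedKKT p x y lam c) {i : Fin l₁}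
    (hi : i ∉ P.actX x) : c.2.2.1 i = 0 := by
  rw [actX, Finset.mem_union, not_or] at hi
  exact le_antisymm (h.suppV i hi.2) (h.suppL i hi.1)

theorem eq_zero_of_not_mem_actY (h : P.IsSignedKKT p x y lam c) {i : Fin l₂}
    (hi : i ∉ P.actY y) : c.2.2.2 i = 0 := by
  rw [actY, Finset.mem_union, not_or] at hi
  exact le_antisymm (h.suppR i hi.2) (h.suppS i hi.1)

theorem mem_suppIn (h : P.IsSignedKKT p x y lam c) :
    c ∈ suppIn (m₁ := m₁) (P.actIneq x y) (P.actX x) (P.actY y) :=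
  ⟨h.suppIneq, fun _ => h.eq_zero_of_not_mem_actX, fun _ => h.eq_zero_of_not_mem_actY⟩

end IsSignedKKT

theorem StrictCompl.ne_zero {P : Problem n₁ n₂ m₁ m₂ l₁ l₂} {x : Fin n₁ → ℝ} {y : Fin n₂ → ℝ}
    {c : (Fin m₁ → ℝ) × (Fin m₂ → ℝ) × (Fin l₁ → ℝ) × (Fin l₂ → ℝ)}
    (hsc : P.StrictCompl x y (signedMult c)) :
    (∀ i ∈ P.actIneq x y, c.2.1 i ≠ 0) ∧ (∀ i ∈ P.actX x, c.2.2.1 i ≠ 0) ∧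
      ∀ j ∈ P.actY y, c.2.2.2 j ≠ 0 := by
  obtain ⟨h1, h2, h3, h4, h5⟩ := hsc
  refine ⟨fun i hi => (h5 i hi).ne', fun i hi h0 => ?_, fun i hi h0 => ?_⟩
  · rcases Finset.mem_union.1 hi with hi | hi
    · simpa [signedMult, h0] using h1 i hi
    · simpa [signedMult, h0] using h2 i hi
  · rcases Finset.mem_union.1 hi with hi | hi
    · simpa [signedMult, h0] using h3 i hi
    · simpa [signedMult, h0] using h4 i hi

end Problem

namespace Trace

variable {n₁ n₂ m₁ m₂ l₁ l₂ : ℕ}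

/-- The signed multipliers of iteration `k`. -/
noncomputable def coeff (P : Problem n₁ n₂ m₁ m₂ l₁ l₂) (p : Params)
    (T : Trace n₁ n₂ m₁ m₂ l₁ l₂) (k : ℕ) :
    (Fin m₁ → ℝ) × (Fin m₂ → ℝ) × (Fin l₁ → ℝ) × (Fin l₂ → ℝ) :=
  (0, (T.sol P p k).μx, T.nuX P p k, T.nuY P p k)

namespace Setting

variable {P : Problem n₁ n₂ m₁ m₂ l₁ l₂} {p : Params} {T : Trace n₁ n₂ m₁ m₂ l₁ l₂}
  {x : Fin n₁ → ℝ} {y : Fin n₂ → ℝ} {lam : Fin m₁ → ℝ} (h : Setting P p T x y lam)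

include h

section Limits

variable {F : Filter ℕ} (hF : F ≤ atTop) {x' : Fin n₁ → ℝ} {y' : Fin n₂ → ℝ} {lam' : Fin m₁ → ℝ}
  (hw : Tendsto T.w F (𝓝 (x', y', lam')))

include hF hw

theorem eventually_supp : ∀ᶠ k in F,
    (∀ i ∉ P.actIneq x' y', (T.sol P p k).μx i = 0) ∧
    (∀ i ∉ P.actL x', 0 ≤ T.nuX P p k i) ∧ (∀ i ∉ P.actV x', T.nuX P p k i ≤ 0) ∧
    (∀ j ∉ P.actS y', 0 ≤ T.nuY P p k j) ∧ (∀ j ∉ P.actR y', T.nuY P p k j ≤ 0) := by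
  filter_upwards [h.eventually_ineq hF hw, h.eventually_act_box hF hw] with k h1 h2
  have hs := h.isStep k
  refine ⟨fun i hi => ?_, fun i hi => ?_, fun i hi => ?_, fun i hi => ?_, fun i hi => ?_⟩
  · by_contra hne
    exact (h1 i hi).not_ge (hs.suppx i hne)
  · by_contra hlt
    exact hi (h2.1.1 (by simpa [Problem.actL] using hs.boxX.eq_lo (not_le.1 hlt)))
  · by_contra hlt
    exact hi (h2.1.2 (by simpa [Problem.actV] using hs.boxX.eq_hi (not_le.1 hlt)))
  · by_contra hlt
    exact hi (h2.2.1 (by simpa [Problem.actS] using hs.boxY.eq_lo (not_le.1 hlt)))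
  · by_contra hlt
    exact hi (h2.2.2 (by simpa [Problem.actR] using hs.boxY.eq_hi (not_le.1 hlt)))

theorem tendsto_combo_coeff : Tendsto (fun k => P.combo (T.coeff P p k)) F
    (𝓝 (-P.stackGrad p (x', y', lam'))) := by
  have h1 : Tendsto (fun k => P.stackGrad p (T.w k)) F (𝓝 (P.stackGrad p (x', y', lam'))) :=
    ((P.continuous_stackGrad p).tendsto _).comp hw
  have h2 : Tendsto (fun k => Sum.elim (0 : Fin n₁ → ℝ)
      (P.Fᵀ *ᵥ ((T.sol P p k).μx - (T.sol P p k).μy))) F (𝓝 0) := by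
    have h3 := ((Continuous.matrix_mulVec (continuous_const (y := P.Fᵀ)) continuous_id).tendsto
      (0 : Fin m₂ → ℝ)).comp (h.tendsto_mu_sub.mono_left hF)
    refine tendsto_pi_nhds.2 fun i => ?_
    rcases i with i | i
    · exact tendsto_const_nhds
    · simpa using tendsto_pi_nhds.1 h3 i
  have h4 := (h1.add (h.tendsto_Hu_du.mono_left hF)).neg.add h2
  rw [add_zero, add_zero] at h4
  exact h4.congr fun k => (h.combo_sol k).symm

theorem tendsto_coeff [F.NeBot] {N : (Fin n₁ ⊕ Fin n₂ → ℝ) →ₗ[ℝ]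
      ((Fin m₁ → ℝ) × (Fin m₂ → ℝ) × (Fin l₁ → ℝ) × (Fin l₂ → ℝ))}
    (hN : ∀ c ∈ Problem.suppIn (m₁ := m₁) (P.actIneq x y) (P.actX x) (P.actY y),
      N (P.combo c) = c)
    (hS : P.actIneq x' y' ⊆ P.actIneq x y) (hL : P.actL x' ⊆ P.actL x)
    (hV : P.actV x' ⊆ P.actV x) (hs : P.actS y' ⊆ P.actS y) (hr : P.actR y' ⊆ P.actR y) :
    Tendsto (T.coeff P p) F (𝓝 (N (-P.stackGrad p (x', y', lam')))) ∧
    P.IsSignedKKT p x' y' lam' (N (-P.stackGrad p (x', y', lam'))) := by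
  have hsupp := h.eventually_supp hF hw
  have hNc : Continuous N := N.continuous_of_finiteDimensional
  have hlim : Tendsto (T.coeff P p) F (𝓝 (N (-P.stackGrad p (x', y', lam')))) := by
    refine ((hNc.tendsto _).comp (h.tendsto_combo_coeff hF hw)).congr' ?_
    filter_upwards [hsupp] with k hk
    refine hN _ ⟨fun i hi => hk.1 i fun hi' => hi (hS hi'), fun i hi => ?_, fun i hi => ?_⟩
    · rw [Problem.actX, Finset.mem_union, not_or] at hi
      exact le_antisymm (hk.2.2.1 i fun hi' => hi.2 (hV hi')) (hk.2.1 i fun hi' => hi.1 (hL hi'))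
    · rw [Problem.actY, Finset.mem_union, not_or] at hi
      exact le_antisymm (hk.2.2.2.2 i fun hi' => hi.2 (hr hi'))
        (hk.2.2.2.1 i fun hi' => hi.1 (hs hi'))
  refine ⟨hlim, ?_⟩
  set c := N (-P.stackGrad p (x', y', lam'))
  have hμ : ∀ i, Tendsto (fun k => (T.sol P p k).μx i) F (𝓝 (c.2.1 i)) := fun i =>
    (((continuous_apply i).comp continuous_snd.fst).tendsto c).comp hlim
  have hX : ∀ i, Tendsto (fun k => T.nuX P p k i) F (𝓝 (c.2.2.1 i)) := fun i =>
    (((continuous_apply i).comp continuous_snd.snd.fst).tendsto c).comp hlim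
  have hY : ∀ i, Tendsto (fun k => T.nuY P p k i) F (𝓝 (c.2.2.2 i)) := fun i =>
    (((continuous_apply i).comp continuous_snd.snd.snd).tendsto c).comp hlim
  constructor
  · exact tendsto_nhds_unique ((continuous_fst.tendsto c).comp hlim) tendsto_const_nhds
  · have h1 := tendsto_nhds_unique
      ((P.combo.continuous_of_finiteDimensional.tendsto c).comp hlim)
      (h.tendsto_combo_coeff hF hw)
    rw [h1, add_neg_cancel]
  · exact tendsto_nhds_unique ((P.continuous_res.tendsto (x', y', lam')).comp hw)
      (h.tendsto_res.mono_left hF)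
  · have hu : Tendsto T.u F (𝓝 (Sum.elim x' y')) := by
      refine tendsto_pi_nhds.2 fun i => ?_
      rcases i with i | i
      · exact tendsto_pi_nhds.1 (tendsto_x hw) i
      · exact tendsto_pi_nhds.1 (tendsto_y hw) i
    exact P.isClosed_feasStack.mem_of_tendsto hu (Eventually.of_forall h.u_mem)
  · exact fun i => ge_of_tendsto' (hμ i) fun k => (h.isStep k).μx_nonneg i
  · exact fun i hi => tendsto_nhds_unique (hμ i)
      (tendsto_const_nhds.congr' (hsupp.mono fun k hk => (hk.1 i hi).symm))
  · exact fun i hi => ge_of_tendsto (hX i) (hsupp.mono fun k hk => hk.2.1 i hi)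
  · exact fun i hi => le_of_tendsto (hX i) (hsupp.mono fun k hk => hk.2.2.1 i hi)
  · exact fun i hi => ge_of_tendsto (hY i) (hsupp.mono fun k hk => hk.2.2.2.1 i hi)
  · exact fun i hi => le_of_tendsto (hY i) (hsupp.mono fun k hk => hk.2.2.2.2 i hi)

end Limits

end Setting

end Trace

namespace Problem

variable {n₁ n₂ m₁ m₂ l₁ l₂ : ℕ} (P : Problem n₁ n₂ m₁ m₂ l₁ l₂)

theorem rowsAll_mulVec_eq_zero {S : Finset (Fin m₂)} {I : Finset (Fin l₁)} {J : Finset (Fin l₂)}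
    {z : Fin n₁ ⊕ Fin n₂ → ℝ} (hA : P.A *ᵥ (z ∘ Sum.inl) + P.B *ᵥ (z ∘ Sum.inr) = 0)
    (hE : ∀ i ∈ S, (P.E *ᵥ (z ∘ Sum.inl) + P.F *ᵥ (z ∘ Sum.inr)) i = 0)
    (hC : ∀ i ∈ I, (P.C *ᵥ (z ∘ Sum.inl)) i = 0) (hD : ∀ j ∈ J, (P.D *ᵥ (z ∘ Sum.inr)) j = 0) :
    P.rowsAll S I J *ᵥ z = 0 := by
  simp only [rowsAll, rowsIneq, Matrix.fromRows_mulVec, Matrix.fromCols_mulVec,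
    Matrix.fromBlocks_mulVec, Matrix.zero_mulVec, add_zero, zero_add]
  ext (i | i | i | i)
  · exact congrFun hA i
  · exact hE i i.2
  · exact hC i i.2
  · exact hD i i.2

end Problem

namespace Trace

variable {n₁ n₂ m₁ m₂ l₁ l₂ : ℕ}

namespace Setting

variable {P : Problem n₁ n₂ m₁ m₂ l₁ l₂} {p : Params} {T : Trace n₁ n₂ m₁ m₂ l₁ l₂}
  {x : Fin n₁ → ℝ} {y : Fin n₂ → ℝ} {lam : Fin m₁ → ℝ} (h : Setting P p T x y lam)

include h

theorem eventually_isolated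
    (hsc : ∀ Λ : Mult m₂ l₁ l₂, P.IsKKT x y lam Λ → P.StrictCompl x y Λ) :
    ∀ᶠ w' in 𝓝 (x, y, lam), MapClusterPt w' atTop T.w → w' = (x, y, lam) := by
  obtain ⟨N, hN⟩ := h.second.licq.exists_inverse
  obtain ⟨U, hU, hUw⟩ := mapClusterPt_iff_ultrafilter.1 h.second.accum
  have hkkt := (h.tendsto_coeff hU hUw hN subset_rfl subset_rfl subset_rfl subset_rfl subset_rfl).2
  have hne := (hsc _ hkkt.isKKT).ne_zero
  have hss := h.second.ssos _ hkkt.isKKT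
  have hcont : Continuous fun w' : (Fin n₁ → ℝ) × (Fin n₂ → ℝ) × (Fin m₁ → ℝ) =>
      N (-P.stackGrad p w') :=
    N.continuous_of_finiteDimensional.comp (P.continuous_stackGrad p).neg
  set c := N (-P.stackGrad p (x, y, lam)) with hc
  have hnear : ∀ᶠ w' in 𝓝 (x, y, lam),
      (∀ i ∈ P.actIneq x y, (N (-P.stackGrad p w')).2.1 i ≠ 0) ∧
      (∀ i ∈ P.actX x, (N (-P.stackGrad p w')).2.2.1 i ≠ 0) ∧
      ∀ i ∈ P.actY y, (N (-P.stackGrad p w')).2.2.2 i ≠ 0 := by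
    refine ((Finset.eventually_all _).2 fun i hi => ?_).and
      (((Finset.eventually_all _).2 fun i hi => ?_).and
      ((Finset.eventually_all _).2 fun i hi => ?_))
    · exact ((continuous_apply i).comp (continuous_snd.fst.comp hcont)).continuousAt.eventually_ne
        (hne.1 i hi)
    · exact ((continuous_apply i).comp
        (continuous_snd.snd.fst.comp hcont)).continuousAt.eventually_ne (hne.2.1 i hi)
    · exact ((continuous_apply i).comp
        (continuous_snd.snd.snd.comp hcont)).continuousAt.eventually_ne (hne.2.2 i hi)
  have hact : ∀ᶠ w' : (Fin n₁ → ℝ) × (Fin n₂ → ℝ) × (Fin m₁ → ℝ) in 𝓝 (x, y, lam),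
      P.actIneq w'.1 w'.2.1 ⊆ P.actIneq x y ∧ (P.actL w'.1 ⊆ P.actL x ∧ P.actV w'.1 ⊆ P.actV x) ∧
      P.actS w'.2.1 ⊆ P.actS y ∧ P.actR w'.2.1 ⊆ P.actR y := by
    have hx := (continuous_fst (X := Fin n₁ → ℝ) (Y := (Fin n₂ → ℝ) × (Fin m₁ → ℝ))).tendsto
      (x, y, lam)
    have hy : Tendsto (fun w' : (Fin n₁ → ℝ) × (Fin n₂ → ℝ) × (Fin m₁ → ℝ) => w'.2.1)
      (𝓝 (x, y, lam)) (𝓝 y) := continuous_snd.fst.tendsto _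
    exact ((hx.prodMk_nhds hy).eventually (P.eventually_actIneq_subset x y)).and
      ((hx.eventually ((P.eventually_actL_subset x).and (P.eventually_actV_subset x))).and
      (hy.eventually ((P.eventually_actS_subset y).and (P.eventually_actR_subset y))))
  obtain ⟨κ, hκ, hpos⟩ := exists_pos_mul_sq_le
    (LinearMap.ker (P.rowsAll (P.actIneq x y) (P.actX x) (P.actY y)).mulVecLin)
    (q := fun z => fderiv ℝ (fderiv ℝ P.obj) (Sum.elim x y) z z) (by fun_prop)
    (fun a z => by simp; ring) (fun z hz hz0 => by
      rw [fderiv_fderiv_apply_eq_hess]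
      refine hss z hz0 ?_
      have hz' : P.rowsAll (P.actIneq x y) (P.actX x) (P.actY y) *ᵥ z = 0 := hz
      simp only [Problem.rowsAll, Problem.rowsIneq, Matrix.fromRows_mulVec,
        Matrix.fromCols_mulVec, Matrix.fromBlocks_mulVec, Matrix.zero_mulVec, add_zero,
        zero_add] at hz'
      have hXmem : ∀ i ∈ P.actX x, (P.C *ᵥ (z ∘ Sum.inl)) i = 0 := fun i hi =>
        congrFun hz' (Sum.inr (Sum.inr (Sum.inl ⟨i, hi⟩)))
      have hYmem : ∀ i ∈ P.actY y, (P.D *ᵥ (z ∘ Sum.inr)) i = 0 := fun i hi =>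
        congrFun hz' (Sum.inr (Sum.inr (Sum.inr ⟨i, hi⟩)))
      refine P.rowsAll_mulVec_eq_zero (funext fun i => congrFun hz' (Sum.inl i))
        (fun i hi => congrFun hz' (Sum.inr (Sum.inl ⟨i, (Finset.mem_filter.1 hi).1⟩)))
        (fun i hi => hXmem i ?_) (fun i hi => hYmem i ?_)
      · exact Finset.union_subset_union (Finset.filter_subset _ _) (Finset.filter_subset _ _) hi
      · exact Finset.union_subset_union (Finset.filter_subset _ _) (Finset.filter_subset _ _) hi)
  have hder : ∀ᶠ w' : (Fin n₁ → ℝ) × (Fin n₂ → ℝ) × (Fin m₁ → ℝ) in 𝓝 (x, y, lam),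
      ‖fderiv ℝ P.obj (Sum.elim w'.1 w'.2.1) - fderiv ℝ P.obj (Sum.elim x y)
        - fderiv ℝ (fderiv ℝ P.obj) (Sum.elim x y) (Sum.elim w'.1 w'.2.1 - Sum.elim x y)‖ ≤
      κ / 2 * ‖(Sum.elim w'.1 w'.2.1 - Sum.elim x y : Fin n₁ ⊕ Fin n₂ → ℝ)‖ := by
    have h1 := (h.differentiableAt_fderiv_obj (u := Sum.elim x y) hkkt.feas).hasFDerivAt.isLittleO.def
      (half_pos hκ)
    have h2 : Continuous fun w' : (Fin n₁ → ℝ) × (Fin n₂ → ℝ) × (Fin m₁ → ℝ) =>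
        (Sum.elim w'.1 w'.2.1 : Fin n₁ ⊕ Fin n₂ → ℝ) := by
      refine continuous_pi fun i => ?_
      rcases i with i | i
      · exact (continuous_apply i).comp continuous_fst
      · exact (continuous_apply i).comp continuous_snd.fst
    exact (h2.tendsto (x, y, lam)).eventually h1
  filter_upwards [hnear, hact, hder] with w' hnear hact hder hcl
  obtain ⟨x', y', lam'⟩ := w'
  obtain ⟨V, hV, hVw⟩ := mapClusterPt_iff_ultrafilter.1 hcl
  have hkkt' := (h.tendsto_coeff hV hVw hN hact.1 hact.2.1.1 hact.2.1.2 hact.2.2.1 hact.2.2.2).2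
  set c' := N (-P.stackGrad p (x', y', lam')) with hc'
  set z : Fin n₁ ⊕ Fin n₂ → ℝ := Sum.elim x' y' - Sum.elim x y with hz
  have hzl : z ∘ Sum.inl = x' - x := rfl
  have hzr : z ∘ Sum.inr = y' - y := rfl
  have hzA : P.A *ᵥ (z ∘ Sum.inl) + P.B *ᵥ (z ∘ Sum.inr) = 0 := by
    have h1 := hkkt.res
    have h2 := hkkt'.res
    rw [hzl, hzr, Matrix.mulVec_sub, Matrix.mulVec_sub]
    unfold Problem.res at h1 h2
    have h3 : P.A *ᵥ x' - P.A *ᵥ x + (P.B *ᵥ y' - P.B *ᵥ y) =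
      (P.A *ᵥ x' + P.B *ᵥ y' - P.b) - (P.A *ᵥ x + P.B *ᵥ y - P.b) := by abel
    rw [h3, h1, h2, sub_zero]
  have hzE : ∀ i ∈ P.actIneq x y, (P.E *ᵥ (z ∘ Sum.inl) + P.F *ᵥ (z ∘ Sum.inr)) i = 0 := by
    intro i hi
    have h1 : P.ineq x y i = 0 := by simpa [Problem.actIneq] using hi
    have h2 : P.ineq x' y' i = 0 := by
      by_contra hcon
      exact hnear.1 i hi (hkkt'.suppIneq i (by simpa [Problem.actIneq] using hcon))
    simp only [Problem.ineq, Pi.add_apply, Pi.sub_apply] at h1 h2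
    simp only [hzl, hzr, Matrix.mulVec_sub, Pi.add_apply, Pi.sub_apply]
    linarith
  have hzC : ∀ i ∈ P.actX x, (P.C *ᵥ (z ∘ Sum.inl)) i = 0 := by
    intro i hi
    have hi' : i ∈ P.actX x' := by
      by_contra hcon
      exact hnear.2.1 i hi (hkkt'.eq_zero_of_not_mem_actX hcon)
    rw [hzl, Matrix.mulVec_sub, Pi.sub_apply, sub_eq_zero]
    rcases Finset.mem_union.1 hi' with hi' | hi'
    · have h1 : ((P.C *ᵥ x) i : EReal) = P.l i := by
        simpa [Problem.actL] using hact.2.1.1 hi'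
      have h2 : ((P.C *ᵥ x') i : EReal) = P.l i := by simpa [Problem.actL] using hi'
      exact EReal.coe_injective (h2.trans h1.symm)
    · have h1 : ((P.C *ᵥ x) i : EReal) = P.v i := by
        simpa [Problem.actV] using hact.2.1.2 hi'
      have h2 : ((P.C *ᵥ x') i : EReal) = P.v i := by simpa [Problem.actV] using hi'
      exact EReal.coe_injective (h2.trans h1.symm)
  have hzD : ∀ i ∈ P.actY y, (P.D *ᵥ (z ∘ Sum.inr)) i = 0 := by
    intro i hi
    have hi' : i ∈ P.actY y' := by
      by_contra hcon
      exact hnear.2.2 i hi (hkkt'.eq_zero_of_not_mem_actY hcon)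
    rw [hzr, Matrix.mulVec_sub, Pi.sub_apply, sub_eq_zero]
    rcases Finset.mem_union.1 hi' with hi' | hi'
    · have h1 : ((P.D *ᵥ y) i : EReal) = P.s i := by
        simpa [Problem.actS] using hact.2.2.1 hi'
      have h2 : ((P.D *ᵥ y') i : EReal) = P.s i := by simpa [Problem.actS] using hi'
      exact EReal.coe_injective (h2.trans h1.symm)
    · have h1 : ((P.D *ᵥ y) i : EReal) = P.r i := by
        simpa [Problem.actR] using hact.2.2.2 hi'
      have h2 : ((P.D *ᵥ y') i : EReal) = P.r i := by simpa [Problem.actR] using hi'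
      exact EReal.coe_injective (h2.trans h1.symm)
  have hsupp : c ∈ Problem.suppIn (P.actIneq x y) (P.actX x) (P.actY y) := hkkt.mem_suppIn
  have hsupp' : c' ∈ Problem.suppIn (P.actIneq x y) (P.actX x) (P.actY y) := by
    refine ⟨fun i hi => hkkt'.suppIneq i fun hi' => hi (hact.1 hi'), fun i hi =>
      hkkt'.eq_zero_of_not_mem_actX fun hi' => hi
        (Finset.union_subset_union hact.2.1.1 hact.2.1.2 hi'), fun i hi =>
      hkkt'.eq_zero_of_not_mem_actY fun hi' => hi
        (Finset.union_subset_union hact.2.2.1 hact.2.2.2 hi')⟩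
  have hcombo : ∀ e ∈ Problem.suppIn (m₁ := m₁) (P.actIneq x y) (P.actX x) (P.actY y),
      P.combo e ⬝ᵥ z = 0 := by
    intro e he
    have hzero : ∀ {κ : Type} [Fintype κ] (S : Finset κ) (a b : κ → ℝ), (∀ i ∉ S, a i = 0) →
        (∀ i ∈ S, b i = 0) → a ⬝ᵥ b = 0 := fun S a b ha hb =>
      Finset.sum_eq_zero fun i _ => by
        by_cases hi : i ∈ S
        · rw [hb i hi, mul_zero]
        · rw [ha i hi, zero_mul]
    rw [P.combo_dotProduct, hzA, dotProduct_zero, hzero _ _ _ he.1 hzE, hzero _ _ _ he.2.1 hzC,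
      hzero _ _ _ he.2.2 hzD]
    ring
  have hgrad : ∀ {x₀ : Fin n₁ → ℝ} {y₀ : Fin n₂ → ℝ} {lam₀ : Fin m₁ → ℝ}
      {c₀ : (Fin m₁ → ℝ) × (Fin m₂ → ℝ) × (Fin l₁ → ℝ) × (Fin l₂ → ℝ)},
      P.IsSignedKKT p x₀ y₀ lam₀ c₀ →
      c₀ ∈ Problem.suppIn (m₁ := m₁) (P.actIneq x y) (P.actX x) (P.actY y) →
      Sum.elim (grad P.f x₀) (grad P.θ y₀) + P.combo (c₀ - (lam₀, 0, 0, 0)) = 0 ∧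
      c₀ - (lam₀, 0, 0, 0) ∈ Problem.suppIn (m₁ := m₁) (P.actIneq x y) (P.actX x) (P.actY y) := by
    intro x₀ y₀ lam₀ c₀ hk hs
    constructor
    · have h1 := hk.stat
      rw [P.stackGrad_eq, hk.res, smul_zero, sub_zero] at h1
      rw [map_sub, ← h1]
      abel
    · exact Submodule.sub_mem _ hs ⟨fun _ _ => rfl, fun _ _ => rfl, fun _ _ => rfl⟩
  have hfz : ∀ {x₀ : Fin n₁ → ℝ} {y₀ : Fin n₂ → ℝ} {lam₀ : Fin m₁ → ℝ}
      {c₀ : (Fin m₁ → ℝ) × (Fin m₂ → ℝ) × (Fin l₁ → ℝ) × (Fin l₂ → ℝ)},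
      P.IsSignedKKT p x₀ y₀ lam₀ c₀ →
      c₀ ∈ Problem.suppIn (m₁ := m₁) (P.actIneq x y) (P.actX x) (P.actY y) →
      fderiv ℝ P.obj (Sum.elim x₀ y₀) z = 0 := by
    intro x₀ y₀ lam₀ c₀ hk hs
    obtain ⟨h1, h2⟩ := hgrad hk hs
    have h3 := congrArg (· ⬝ᵥ z) h1
    simp only [add_dotProduct, hcombo _ h2, add_zero, zero_dotProduct] at h3
    rw [P.fderiv_obj_apply, ← h3]
    conv_rhs => rw [← Sum.elim_comp_inl_inr z, sumElim_dotProduct_sumElim]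
    rfl
  have hz0 : z = 0 := by
    have h1 := hpos z (P.rowsAll_mulVec_eq_zero hzA hzE hzC hzD)
    have h2 := (fderiv ℝ P.obj (Sum.elim x' y') - fderiv ℝ P.obj (Sum.elim x y)
      - fderiv ℝ (fderiv ℝ P.obj) (Sum.elim x y) z).le_opNorm z
    change ‖fderiv ℝ P.obj (Sum.elim x' y') z - fderiv ℝ P.obj (Sum.elim x y) z
      - fderiv ℝ (fderiv ℝ P.obj) (Sum.elim x y) z z‖ ≤ _ at h2
    rw [hfz hkkt' hsupp', hfz hkkt hsupp, sub_zero, zero_sub, norm_neg] at h2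
    have h3 := (le_abs_self _).trans (h2.trans (mul_le_mul_of_nonneg_right hder (norm_nonneg z)))
    have h4 : κ / 2 * ‖z‖ ^ 2 ≤ 0 := by nlinarith
    have h5 : ‖z‖ ^ 2 ≤ 0 := nonpos_of_mul_nonpos_right h4 (half_pos hκ)
    exact norm_eq_zero.1 (pow_eq_zero_iff two_ne_zero |>.1 (le_antisymm h5 (sq_nonneg _)))
  have hx : x' = x := by rw [← sub_eq_zero, ← hzl, hz0]; rfl
  have hy : y' = y := by rw [← sub_eq_zero, ← hzr, hz0]; rfl
  obtain ⟨h1, h2⟩ := hgrad hkkt hsupp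
  obtain ⟨h1', h2'⟩ := hgrad hkkt' hsupp'
  rw [hx, hy, ← h1] at h1'
  have h3 := congrArg N (add_left_cancel h1')
  rw [hN _ h2, hN _ h2'] at h3
  have h4 := congrArg Prod.fst h3
  simp only [Prod.fst_sub, hkkt.fst, hkkt'.fst, zero_sub, neg_inj] at h4
  rw [hx, hy, h4]

theorem tendsto_w (hsc : ∀ Λ : Mult m₂ l₁ l₂, P.IsKKT x y lam Λ → P.StrictCompl x y Λ) :
    Tendsto T.w atTop (𝓝 (x, y, lam)) :=
  tendsto_of_isolated_mapClusterPt h.second.accum h.tendsto_dist_w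
    ((h.eventually_isolated hsc).mono fun _ hb hcl => by rw [hb hcl, dist_self])

end Setting

end Trace

theorem sum_coe_mul_le_sum {ι : Type} [Fintype ι] (S : Finset ι) {m : ℝ} {a b : ι → ℝ}
    (ha : ∀ i, 0 ≤ a i) (hb : ∀ i, 0 ≤ b i) (hm : ∀ i ∈ S, m ≤ a i) :
    m * ∑ i : S, b i ≤ ∑ i, a i * b i := by
  rw [Finset.sum_coe_sort S b, Finset.mul_sum]
  exact (Finset.sum_le_sum fun i hi => mul_le_mul_of_nonneg_right (hm i hi) (hb i)).trans
    (Finset.sum_le_sum_of_subset_of_nonneg (Finset.subset_univ S)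
      fun i _ _ => mul_nonneg (ha i) (hb i))

theorem exists_eventually_le_abs {ι : Type} (S : Finset ι) {F : Filter ℕ} {a : ℕ → ι → ℝ}
    {b : ι → ℝ} (hab : ∀ i, Tendsto (fun k => a k i) F (𝓝 (b i))) (hb : ∀ i ∈ S, b i ≠ 0) :
    ∃ m, 0 < m ∧ ∀ᶠ k in F, ∀ i ∈ S, m ≤ |a k i| := by
  classical
  induction S using Finset.induction_on with
  | empty => exact ⟨1, one_pos, by simp⟩
  | insert j S _ ih =>
    obtain ⟨m, hm, h⟩ := ih fun i hi => hb i (Finset.mem_insert_of_mem hi)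
    have hj := abs_pos.2 (hb j (Finset.mem_insert_self j S))
    refine ⟨min m (|b j| / 2), lt_min hm (half_pos hj), ?_⟩
    filter_upwards [h, (hab j).abs.eventually_const_lt (half_lt_self hj)] with k h1 h2 i hi
    rcases Finset.mem_insert.1 hi with rfl | hi
    · exact (min_le_right _ _).trans h2.le
    · exact (min_le_left _ _).trans (h1 i hi)

theorem abs_dotProduct_le_sum {ι : Type} [Fintype ι] (a b : ι → ℝ) :
    |a ⬝ᵥ b| ≤ (∑ i, |a i|) * ‖b‖ := by
  rw [Finset.sum_mul]
  refine (Finset.abs_sum_le_sum_abs _ _).trans (Finset.sum_le_sum fun i _ => ?_)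
  rw [abs_mul]
  exact mul_le_mul_of_nonneg_left (norm_le_pi_norm b i) (abs_nonneg _)

namespace Problem

variable {n₁ n₂ m₁ m₂ l₁ l₂ : ℕ} (P : Problem n₁ n₂ m₁ m₂ l₁ l₂)

theorem exists_gram_inv_bound : ∃ C, 0 ≤ C ∧ ∀ S I J (v : Fin n₁ ⊕ Fin n₂ → ℝ),
    ‖((P.rowsIneq S I J * (P.rowsIneq S I J)ᵀ)⁻¹ * P.rowsIneq S I J) *ᵥ v‖ ≤ C * ‖v‖ := by
  let q : Finset (Fin m₂) × Finset (Fin l₁) × Finset (Fin l₂) → ℝ := fun s =>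
    ‖((P.rowsIneq s.1 s.2.1 s.2.2 * (P.rowsIneq s.1 s.2.1 s.2.2)ᵀ)⁻¹ *
      P.rowsIneq s.1 s.2.1 s.2.2).mulVecLin.toContinuousLinearMap‖
  obtain ⟨C, hC⟩ := (Set.finite_range q).bddAbove
  have hC' : ∀ s, q s ≤ C := fun s => hC ⟨s, rfl⟩
  refine ⟨C, (norm_nonneg _).trans (hC' (∅, ∅, ∅)), fun S I J v => ?_⟩
  exact (ContinuousLinearMap.le_opNorm (LinearMap.toContinuousLinearMap
    ((P.rowsIneq S I J * (P.rowsIneq S I J)ᵀ)⁻¹ * P.rowsIneq S I J).mulVecLin) v).trans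
    (mul_le_mul_of_nonneg_right (hC' (S, I, J)) (norm_nonneg v))

end Problem

namespace Trace

variable {n₁ n₂ m₁ m₂ l₁ l₂ : ℕ}

namespace Setting

variable {P : Problem n₁ n₂ m₁ m₂ l₁ l₂} {p : Params} {T : Trace n₁ n₂ m₁ m₂ l₁ l₂}
  {x : Fin n₁ → ℝ} {y : Fin n₂ → ℝ} {lam : Fin m₁ → ℝ} (h : Setting P p T x y lam)

include h

theorem sum_abs_calB (k : ℕ) : ∑ r, |(T.calB P p k *ᵥ T.du P p k) r| =
    ∑ i : T.Splus P p k, |P.ineq (T.x k) (T.y k) i|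
      + ∑ i : P.actX (T.xt P p k), |(P.C *ᵥ T.dx P p k) i|
      + ∑ j : P.actY (T.yt P p k), |(P.D *ᵥ T.dy P p k) j| := by
  simp only [calB, Problem.rowsIneq, du, Matrix.fromRows_mulVec, Matrix.fromCols_mulVec,
    Matrix.fromBlocks_mulVec, Matrix.zero_mulVec, add_zero, zero_add, Sum.elim_comp_inl,
    Sum.elim_comp_inr, Fintype.sum_sum_type, Sum.elim_inl, Sum.elim_inr]
  rw [← add_assoc]
  congr 2
  refine Finset.sum_congr rfl fun i _ => ?_
  rw [← abs_neg (P.ineq _ _ _), ← (h.isStep k).splus i i.2]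
  rfl

theorem exists_mul_sum_le_multTerm
    (hsc : ∀ Λ : Mult m₂ l₁ l₂, P.IsKKT x y lam Λ → P.StrictCompl x y Λ) :
    ∃ m, 0 < m ∧ ∀ᶠ k in atTop,
      m * ∑ r, |(T.calB P p k *ᵥ T.du P p k) r| ≤ multTerm P p T k := by
  obtain ⟨N, hN⟩ := h.second.licq.exists_inverse
  have hw := h.tendsto_w hsc
  obtain ⟨hlim, hkkt⟩ := h.tendsto_coeff le_rfl hw hN subset_rfl subset_rfl subset_rfl
    subset_rfl subset_rfl
  have hne := (hsc _ hkkt.isKKT).ne_zero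
  set c := N (-P.stackGrad p (x, y, lam))
  obtain ⟨ma, hma, ha⟩ := exists_eventually_le_abs (P.actIneq x y)
    (a := fun k => (T.sol P p k).μx) (fun i =>
      (((continuous_apply i).comp continuous_snd.fst).tendsto c).comp hlim) hne.1
  obtain ⟨mb, hmb, hb⟩ := exists_eventually_le_abs (P.actX x) (a := fun k => T.nuX P p k)
    (fun i => (((continuous_apply i).comp continuous_snd.snd.fst).tendsto c).comp hlim) hne.2.1
  obtain ⟨mc, hmc, hc⟩ := exists_eventually_le_abs (P.actY y) (a := fun k => T.nuY P p k)
    (fun i => (((continuous_apply i).comp continuous_snd.snd.snd).tendsto c).comp hlim) hne.2.2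
  refine ⟨min (ma / 2) (min mb mc), by positivity, ?_⟩
  filter_upwards [ha, hb, hc, h.eventually_act_box le_rfl hw, h.eventually_ineq le_rfl hw]
    with k ha hb hc hbox hineq
  have hs := h.isStep k
  have hX : P.actX (T.xt P p k) ⊆ P.actX x := Finset.union_subset_union hbox.1.1 hbox.1.2
  have hY : P.actY (T.yt P p k) ⊆ P.actY y := Finset.union_subset_union hbox.2.1 hbox.2.2
  have hSp : T.Splus P p k ⊆ P.actIneq x y := fun i hi => by
    by_contra hcon
    have h1 := hineq i hcon
    have h2 := hs.splus i hi
    rw [← abs_neg (P.ineq _ _ _), ← h2] at h1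
    linarith [abs_add_le ((P.E *ᵥ T.dx P p k) i) ((P.F *ᵥ T.dy P p k) i),
      abs_nonneg ((P.E *ᵥ T.dx P p k) i), abs_nonneg ((P.F *ᵥ T.dy P p k) i)]
  rw [h.sum_abs_calB, mul_add, mul_add, multTerm]
  refine add_le_add (add_le_add ?_ ?_) ?_
  · refine sum_coe_mul_le_sum (T.Splus P p k)
      (a := fun i => ((T.sol P p k).μx i + (T.sol P p k).μy i) / 2)
      (b := fun i => |P.ineq (T.x k) (T.y k) i|) (fun i => ?_) (fun i => abs_nonneg _)
      (fun i hi => (min_le_left _ _).trans ?_)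
    · linarith [hs.μx_nonneg i, hs.μy_nonneg i]
    · have := ha i (hSp hi)
      rw [abs_of_nonneg (hs.μx_nonneg i)] at this
      linarith [hs.μy_nonneg i]
  · exact sum_coe_mul_le_sum (P.actX (T.xt P p k)) (a := fun i => |T.nuX P p k i|)
      (b := fun i => |(P.C *ᵥ T.dx P p k) i|) (fun _ => abs_nonneg _) (fun _ => abs_nonneg _)
      fun i hi => ((min_le_right _ _).trans (min_le_left _ _)).trans (hb i (hX hi))
  · exact sum_coe_mul_le_sum (P.actY (T.yt P p k)) (a := fun i => |T.nuY P p k i|)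
      (b := fun i => |(P.D *ᵥ T.dy P p k) i|) (fun _ => abs_nonneg _) (fun _ => abs_nonneg _)
      fun i hi => ((min_le_right _ _).trans (min_le_right _ _)).trans (hc i (hY hi))

theorem exists_hessErr_bound : ∃ C, 0 ≤ C ∧ ∀ k, ‖T.hessErr P p k‖ ≤ C * ‖T.du P p k‖ := by
  obtain ⟨R, hR0, hR⟩ := h.exists_Hu_bound
  obtain ⟨K, hK, -, hsub, hmem⟩ := h.exists_compact
  obtain ⟨C, hC⟩ := exists_norm_add_le hK (h.continuousOn_fderiv_fderiv_obj.mono hsub)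
    (P.penaltyHess p.β)
  have hC0 : 0 ≤ max C 0 := le_max_right _ _
  refine ⟨Fintype.card (Fin n₁ ⊕ Fin n₂) * (R + max C 0), by positivity, fun k => ?_⟩
  refine norm_mulVec_le (by positivity) (fun i j => ?_) _
  rw [Matrix.sub_apply]
  refine (abs_sub _ _).trans (add_le_add (hR k i j) ?_)
  refine (abs_hess_le (P.stackLag p.β (T.lam k)) (T.u k) i j).trans ?_
  rw [h.fderiv_fderiv_stackLag (h.u_mem k)]
  exact le_trans (by simpa using hC _ (hmem k).1) (le_max_left C 0)

omit h in
theorem eventually_abs_dotProduct_le {a : ℕ → Fin n₁ ⊕ Fin n₂ → ℝ}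
    (ha : (fun k => enorm2 (a k)) =o[atTop] fun k => enorm2 (T.du P p k)) {ε : ℝ} (hε : 0 < ε) :
    ∀ᶠ k in atTop, |T.du P p k ⬝ᵥ a k| ≤ ε * ‖T.du P p k‖ ^ 2 := by
  have ha' : (fun k => ‖a k‖) =o[atTop] fun k => ‖T.du P p k‖ :=
    ((enorm2_isTheta atTop a).2.trans_isLittleO ha).trans_isTheta (enorm2_isTheta atTop _)
  have hε' : 0 < ε / (Fintype.card (Fin n₁ ⊕ Fin n₂) + 1) := by positivity
  filter_upwards [ha'.def hε'] with k hk
  rw [norm_norm, norm_norm, div_mul_eq_mul_div, le_div_iff₀ (by positivity)] at hk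
  refine (abs_dotProduct_le _ _).trans ?_
  nlinarith [norm_nonneg (a k), norm_nonneg (T.du P p k)]

omit h in
theorem du_dotProduct_hessErr (k : ℕ) : T.du P p k ⬝ᵥ T.hessErr P p k =
    T.du P p k ⬝ᵥ (T.proj P p k *ᵥ T.hessErr P p k) + (T.calB P p k *ᵥ T.du P p k) ⬝ᵥ
      (((T.calB P p k * (T.calB P p k)ᵀ)⁻¹ * T.calB P p k) *ᵥ T.hessErr P p k) := by
  rw [proj, Matrix.sub_mulVec, Matrix.one_mulVec, dotProduct_sub, Matrix.mul_assoc,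
    ← Matrix.mulVec_mulVec _ (T.calB P p k)ᵀ, Matrix.dotProduct_mulVec _ (T.calB P p k)ᵀ,
    Matrix.vecMul_transpose]
  ring

theorem eventually_hessErr_le_of_projApprox (hproj : T.ProjApprox P p)
    (hsc : ∀ Λ : Mult m₂ l₁ l₂, P.IsKKT x y lam Λ → P.StrictCompl x y Λ) {ε : ℝ} (hε : 0 < ε) :
    ∀ᶠ k in atTop, |T.du P p k ⬝ᵥ T.hessErr P p k| ≤
      ε * ‖T.du P p k‖ ^ 2 + multTerm P p T k := by
  obtain ⟨m, hm, hmult⟩ := h.exists_mul_sum_le_multTerm hsc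
  obtain ⟨C₁, hC₁, h1⟩ := P.exists_gram_inv_bound
  obtain ⟨C₂, hC₂, h2⟩ := h.exists_hessErr_bound
  have hsmall : ∀ᶠ k in atTop, C₁ * C₂ * ‖T.du P p k‖ < m := by
    have := h.tendsto_du_res.1.const_mul (C₁ * C₂)
    rw [mul_zero] at this
    exact this.eventually_lt_const hm
  filter_upwards [hmult, hsmall, eventually_abs_dotProduct_le hproj hε] with k hk1 hk2 hk3
  rw [du_dotProduct_hessErr]
  refine (abs_add_le _ _).trans (add_le_add hk3 (le_trans ?_ hk1))
  refine (abs_dotProduct_le_sum _ _).trans ?_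
  rw [mul_comm m]
  refine mul_le_mul_of_nonneg_left ?_ (Finset.sum_nonneg fun _ _ => abs_nonneg _)
  refine (h1 _ _ _ _).trans (le_trans ?_ hk2.le)
  rw [mul_assoc]
  exact mul_le_mul_of_nonneg_left (h2 k) hC₁

end Setting

end Trace

end PFDSQO

theorem theorem5 {n₁ n₂ m₁ m₂ l₁ l₂ : ℕ} (P : PFDSQO.Problem n₁ n₂ m₁ m₂ l₁ l₂)
    (p : PFDSQO.Params) (hc : p.c = 1) (hρ : p.ρ ∈ Set.Ioo (0 : ℝ) (1 / 2))
    (T : PFDSQO.Trace n₁ n₂ m₁ m₂ l₁ l₂) (hT : T.IsRun P p)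
    (hH : T.UniformHessians P p)
    (x : Fin n₁ → ℝ) (y : Fin n₂ → ℝ) (lam : Fin m₁ → ℝ)
    (hS : T.SecondOrder P x y lam)
    (hAB : P.Aᵀ * P.B = 0)
    (hDM : T.FullApprox P p ∨
      (T.ProjApprox P p ∧
        ∀ Λ : PFDSQO.Mult m₂ l₁ l₂, P.IsKKT x y lam Λ → P.StrictCompl x y Λ)) :
    ∀ᶠ k in atTop, T.t k = 1 := by
  have h : PFDSQO.Trace.Setting P p T x y lam := ⟨hc, hT, hH, hS, hAB⟩
  refine h.eventually_t_eq_one hρ.2 fun ε hε => ?_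
  rcases hDM with hfull | ⟨hproj, hsc⟩
  · filter_upwards [PFDSQO.Trace.Setting.eventually_abs_dotProduct_le hfull hε] with k hk
    exact hk.trans (le_add_of_nonneg_right (h.multTerm_nonneg k))
  · exact h.eventually_hessErr_le_of_projApprox hproj hsc hε
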